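/- Let $M$ be a smooth manifold of even dimension $n$ and let $\nabla$ be a smooth torsion-free connection in $TM$, with curvature $R(X,Y)Z=\nabla_X\nabla_YZ-\nabla_Y\nabla_XZ-\nabla_{[X,Y]}Z$ and Ricci curvature $r(X,Y)=\operatorname{Tr}(Z\mapsto R(X,Z)Y)$. Let $r_+$ and $r_-$ be the symmetric and skew parts of $r$. For a bilinear form $Q$ on $TM$ put $$[Q\wedge\mathrm{Id}](X,Y)Z=-Q(X,Y)Z-Q(X,Z)Y+Q(Y,X)Z+Q(Y,Z)X .$$ The Weyl curvature $W^\nabla$ of $\nabla$ is defined by $$R=W^\nabla-\tfrac1{n-1}[r_+\wedge\mathrm{Id}]-\tfrac1{n+1}[r_-\wedge\mathrm{Id}].$$ Let $\pi\colon J(M)\to M$ be the bundle whose fibre at $x\in M$ consists of all endomorphisms $j$ of $T_xM$ with $j^2=-1$; it is a submanifold of the total space of $\operatorname{End}(TM)$. Let $\mathcal J$ be the tautological section of $\pi^*\operatorname{End}(TM)$, $\mathcal J_j=j$, and let $\pi^*\nabla$ be the pull-back connection. Let $J^\nabla$ be the unique almost complex structure on $J(M)$ with $$d\pi(J^\nabla\xi)=\mathcal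 J\,d\pi(\xi)\quad\text{and}\quad \pi^*\nabla_{J^\nabla\xi}\mathcal J=\mathcal J\,\pi^*\nabla_{\xi}\mathcal J$$ for all tangent vectors $\xi$ of $J(M)$. **Theorem.** $J^\nabla$ is integrable (that is, its Nijenhuis tensor $N(X,Y)=[J^\nabla X,J^\nabla Y]-J^\nabla[J^\nabla X,Y]-J^\nabla[X,J^\nabla Y]-[X,Y]$ vanishes) if and only if $W^\nabla=0$. -/

import Mathlib

open Bundle FiberBundle VectorField Filter Module
open scoped Manifold ContDiff Topology

noncomputable section

namespace TwistorWeyl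

section General

variable {EN : Type*} [NormedAddCommGroup EN] [NormedSpace ℝ EN]
  {HN : Type*} [TopologicalSpace HN] {N : Type*} [TopologicalSpace N] [ChartedSpace HN N]

/-- Let `S` be a submanifold of a manifold `N` with tangent spaces `T p ⊆ T_p N` (`p ∈ S`), and let
`J` be an almost complex structure on `S`, given at `p ∈ S` by the restriction of `J p` to `T p`.
`J` is integrable if its Nijenhuis tensor
`N(X, Y) = [JX, JY] - J[JX, Y] - J[X, JY] - [X, Y]` vanishes, for all smooth local vector fields
`X`, `Y` of `S`. A smooth local vector field of `S` near `p` is represented by a smooth local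
vector field of `N` that is tangent to `S` along `S`; brackets of such fields are again tangent to
`S` along `S`, where they depend only on the restrictions of the fields to `S`. In the formula
below `X'` and `Y'` represent `JX` and `JY`. Only the values of `T` and `J` on `S` matter. -/
def IsIntegrableOn (I : ModelWithCorners ℝ EN HN) [IsManifold I 1 N] (S : Set N)
    (T : ∀ p : N, Submodule ℝ (TangentSpace I p))
    (J : ∀ p : N, TangentSpace I p → TangentSpace I p) : Prop :=
  ∀ p ∈ S, ∀ X Y X' Y' : (∀ q : N, TangentSpace I q),
    CMDiffAt ∞ (T% X) p → CMDiffAt ∞ (T% Y) p →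
    CMDiffAt ∞ (T% X') p → CMDiffAt ∞ (T% Y') p →
    (∀ᶠ q in 𝓝[S] p, X q ∈ T q ∧ X' q = J q (X q)) →
    (∀ᶠ q in 𝓝[S] p, Y q ∈ T q ∧ Y' q = J q (Y q)) →
    mlieBracket I X' Y' p - J p (mlieBracket I X' Y p) - J p (mlieBracket I X Y' p)
      - mlieBracket I X Y p = 0

end General

set_option linter.unusedSectionVars false

variable {E : Type*} [NormedAddCommGroup E] [NormedSpace ℝ E] [FiniteDimensional ℝ E]
  {M : Type*} [TopologicalSpace M] [ChartedSpace E M] [IsManifold 𝓘(ℝ, E) ∞ M]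

variable (E) in
/-- A connection in the tangent bundle `TM`: `nabla Y x (X x)` is `(∇_X Y)(x)`. -/
abbrev Connection (M : Type*) [TopologicalSpace M] [ChartedSpace E M]
    [IsManifold 𝓘(ℝ, E) ∞ M] : Type _ :=
  CovariantDerivative 𝓘(ℝ, E) E (TangentSpace 𝓘(ℝ, E) : M → Type _)

/-! ### Curvature -/

section Curvature

variable (nabla : Connection E M)

/-- `∇_X∇_Y Z - ∇_Y∇_X Z - ∇_{[X,Y]} Z` at the point `x`. -/
def curvatureField (X Y Z : ∀ y : M, TangentSpace 𝓘(ℝ, E) y) (x : M) : TangentSpace 𝓘(ℝ, E) x :=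
  nabla (fun y => nabla Z y (Y y)) x (X x) - nabla (fun y => nabla Z y (X y)) x (Y x)
    - nabla Z x (mlieBracket 𝓘(ℝ, E) X Y x)

/-- The curvature tensor `R(u, v)w` at `x`: tangent vectors at `x` are extended to vector fields
that are smooth near `x`. -/
def curvature (x : M) (u v w : TangentSpace 𝓘(ℝ, E) x) : TangentSpace 𝓘(ℝ, E) x :=
  curvatureField nabla (extend E u) (extend E v) (extend E w) x

/-- The Ricci curvature `r(u, v)`, the trace of `z ↦ R(u, z)v`, computed in a basis of `T_x M`. -/
def ricci (x : M) (u v : TangentSpace 𝓘(ℝ, E) x) : ℝ :=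
  let b : Basis _ ℝ (TangentSpace 𝓘(ℝ, E) x) := finBasis ℝ E
  ∑ i, b.repr (curvature nabla x u (b i) v) i

/-- The symmetric part of the Ricci curvature. -/
def ricciSymm (x : M) (u v : TangentSpace 𝓘(ℝ, E) x) : ℝ :=
  (ricci nabla x u v + ricci nabla x v u) / 2

/-- The skew part of the Ricci curvature. -/
def ricciSkew (x : M) (u v : TangentSpace 𝓘(ℝ, E) x) : ℝ :=
  (ricci nabla x u v - ricci nabla x v u) / 2

/-- For a bilinear form `Q` on `V`, the tensor `[Q ∧ Id](u, v) = [Q(u), v] - [Q(v), u]` with values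
in `End V`, where `Q(u) = Q(u, ·)` and `[α, v]w = -(α(v)w + α(w)v)` for `α ∈ V*`, `v ∈ V`. -/
def wedgeId {V : Type*} [AddCommGroup V] [Module ℝ V] (Q : V → V → ℝ) (u v w : V) : V :=
  -(Q u v • w + Q u w • v) + (Q v u • w + Q v w • u)

/-- The Weyl component of the curvature, with `n = dim M`:
`R = W - (1/(n-1)) [r₊ ∧ Id] - (1/(n+1)) [r₋ ∧ Id]`. -/
def weyl (x : M) (u v w : TangentSpace 𝓘(ℝ, E) x) : TangentSpace 𝓘(ℝ, E) x :=
  curvature nabla x u v w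
    + (1 / ((finrank ℝ E : ℝ) - 1)) • wedgeId (ricciSymm nabla x) u v w
    + (1 / ((finrank ℝ E : ℝ) + 1)) • wedgeId (ricciSkew nabla x) u v w

end Curvature

/-! ### The twistor space -/

variable (E M) in
/-- The total space of the bundle `End(TM)`. A point is a pair `p = ⟨x, j⟩`, `j ∈ End(T_x M)`. -/
abbrev EndTM : Type _ :=
  TotalSpace (E →L[ℝ] E)
    (fun x : M => TangentSpace 𝓘(ℝ, E) x →L[ℝ] TangentSpace 𝓘(ℝ, E) x)

variable (E) in
/-- The model with corners of the manifold `EndTM E M`. -/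
abbrev endModel : ModelWithCorners ℝ (E × (E →L[ℝ] E)) (ModelProd E (E →L[ℝ] E)) :=
  𝓘(ℝ, E).prod 𝓘(ℝ, E →L[ℝ] E)

variable (E M) in
/-- The bundle `J(M)` of all `j ∈ End(T_x M)`, `x ∈ M`, with `j² = -1`, as a subset (in fact, a
closed submanifold) of the total space of `End(TM)`. -/
def twistorSpace : Set (EndTM E M) :=
  {p | ∀ w : TangentSpace 𝓘(ℝ, E) p.1, p.2 (p.2 w) = -w}

/-- The horizontal component `v = dπ(ξ) ∈ T_x M` of a tangent vector `ξ` of `End(TM)` at `p`, in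
the chart around `p` given by the preferred chart of `M` around `x = π(p)`. -/
def horizontalPart {p : EndTM E M} (ξ : TangentSpace (endModel E) p) : TangentSpace 𝓘(ℝ, E) p.1 :=
  (show E × (E →L[ℝ] E) from ξ).1

/-- The fibre component `a ∈ End(T_x M)` of a tangent vector `ξ` of `End(TM)` at `p`, in the chart
around `p` given by the preferred chart of `M` around `x = π(p)`. -/
def fibrePart {p : EndTM E M} (ξ : TangentSpace (endModel E) p) :
    TangentSpace 𝓘(ℝ, E) p.1 →L[ℝ] TangentSpace 𝓘(ℝ, E) p.1 :=
  (show E × (E →L[ℝ] E) from ξ).2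

theorem mfderiv_proj_eq (p : EndTM E M) (ξ : TangentSpace (endModel E) p) :
    mfderiv (endModel E) 𝓘(ℝ, E) (TotalSpace.proj : EndTM E M → M) p ξ = horizontalPart ξ := by
  have h : HasMFDerivAt (endModel E) 𝓘(ℝ, E) (TotalSpace.proj : EndTM E M → M) p
      (ContinuousLinearMap.fst ℝ E (E →L[ℝ] E)) := by
    refine ⟨(FiberBundle.continuous_proj _ _).continuousAt, ?_⟩
    refine hasFDerivWithinAt_fst.congr_of_eventuallyEq ?_ ?_
    · filter_upwards [extChartAt_target_mem_nhdsWithin (I := endModel E) p] with u hu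
      have h := (extChartAt 𝓘(ℝ, E) p.proj).right_inv
        ((FiberBundle.extChartAt_target (IB := 𝓘(ℝ, E)) p ▸ hu).1.1)
      rw [writtenInExtChartAt, Function.comp_apply, Function.comp_apply,
        FiberBundle.extChartAt]
      have h' := (trivializationAt (E →L[ℝ] E)
        (fun x => TangentSpace 𝓘(ℝ, E) x →L[ℝ] TangentSpace 𝓘(ℝ, E) x) p.proj).proj_symm_apply'
          (x := u.2) (FiberBundle.extChartAt_target (IB := 𝓘(ℝ, E)) p ▸ hu).1.2
      exact (congrArg (extChartAt 𝓘(ℝ, E) p.proj) h').trans h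
    · rw [writtenInExtChartAt, Function.comp_apply, Function.comp_apply, extChartAt_to_inv]
      rw [FiberBundle.extChartAt]
      simp
  rw [h.mfderiv]
  rfl

theorem extend_add_eventually {x : M} (u v : TangentSpace 𝓘(ℝ, E) x) :
    ∀ᶠ y in 𝓝 x, extend E (u + v) y = (extend E u + extend E v) y := by
  have hx := FiberBundle.mem_baseSet_trivializationAt' (F := E) (E := TangentSpace 𝓘(ℝ, E)) x
  filter_upwards [(trivializationAt E (TangentSpace 𝓘(ℝ, E)) x).open_baseSet.mem_nhds hx] with y hy
  have key : ∀ e : E, (trivializationAt E (TangentSpace 𝓘(ℝ, E)) x).symm y e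
      = (trivializationAt E (TangentSpace 𝓘(ℝ, E)) x).symmL ℝ y e :=
    fun e => ((trivializationAt E (TangentSpace 𝓘(ℝ, E)) x).symmL_apply (R := ℝ) hy e).symm
  simp only [extend, Pi.add_apply]
  rw [((trivializationAt E (TangentSpace 𝓘(ℝ, E)) x).linear ℝ hx).map_add]
  simp only [key, map_add]

theorem extend_smul_eventually {x : M} (c : ℝ) (v : TangentSpace 𝓘(ℝ, E) x) :
    ∀ᶠ y in 𝓝 x, extend E (c • v) y = (c • extend E v) y := by
  have hx := FiberBundle.mem_baseSet_trivializationAt' (F := E) (E := TangentSpace 𝓘(ℝ, E)) x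
  filter_upwards [(trivializationAt E (TangentSpace 𝓘(ℝ, E)) x).open_baseSet.mem_nhds hx] with y hy
  have key : ∀ e : E, (trivializationAt E (TangentSpace 𝓘(ℝ, E)) x).symm y e
      = (trivializationAt E (TangentSpace 𝓘(ℝ, E)) x).symmL ℝ y e :=
    fun e => ((trivializationAt E (TangentSpace 𝓘(ℝ, E)) x).symmL_apply (R := ℝ) hy e).symm
  simp only [extend, Pi.smul_apply]
  rw [((trivializationAt E (TangentSpace 𝓘(ℝ, E)) x).linear ℝ hx).map_smul]
  simp only [key, map_smul]

variable (nabla : Connection E M)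

/-- The Christoffel operator `Γ(v) : w ↦ ∇_v W` at `x`, where `W` is the vector field which has
value `w` at `x` and is constant in the preferred chart of `M` around `x`. -/
def christoffel (x : M) (v : TangentSpace 𝓘(ℝ, E) x) :
    TangentSpace 𝓘(ℝ, E) x →L[ℝ] TangentSpace 𝓘(ℝ, E) x :=
  haveI : FiniteDimensional ℝ (TangentSpace 𝓘(ℝ, E) x) := inferInstanceAs (FiniteDimensional ℝ E)
  haveI : T2Space (TangentSpace 𝓘(ℝ, E) x) := inferInstanceAs (T2Space E)
  LinearMap.toContinuousLinearMap
    { toFun := fun w => nabla (extend E w) x v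
      map_add' := fun w₁ w₂ => by
        rw [nabla.isCovariantDerivativeOnUniv.congr_of_eventuallyEq
          (mdifferentiableAt_extend 𝓘(ℝ, E) E _)
          (mdifferentiableAt_add_section (mdifferentiableAt_extend 𝓘(ℝ, E) E w₁)
            (mdifferentiableAt_extend 𝓘(ℝ, E) E w₂)) univ_mem (extend_add_eventually w₁ w₂),
          nabla.isCovariantDerivativeOnUniv.add
          (mdifferentiableAt_extend 𝓘(ℝ, E) E _) (mdifferentiableAt_extend 𝓘(ℝ, E) E _)]
        rfl
      map_smul' := fun c w => by
        rw [nabla.isCovariantDerivativeOnUniv.congr_of_eventuallyEq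
          (mdifferentiableAt_extend 𝓘(ℝ, E) E _)
          (mdifferentiableAt_const.smul_section (f := fun _ => c)
            (mdifferentiableAt_extend 𝓘(ℝ, E) E w))
          univ_mem (extend_smul_eventually c w)]
        change nabla (c • extend E w) x v = _
        rw [nabla.isCovariantDerivativeOnUniv.smul_const c
          (mdifferentiableAt_extend 𝓘(ℝ, E) E _)]
        rfl }

/-- The value at `ξ ∈ T_p End(TM)`, `p = ⟨x, j⟩`, of the covariant differential `π*∇ 𝒥` of the
tautological section `𝒥` (with `𝒥_p = j`) of the pull-back of `End(TM)`: in the frame given by the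
preferred chart around `x` this is `a + [Γ(v), j]`, where `v` and `a` are the components of `ξ`. -/
def nablaTaut (p : EndTM E M) (ξ : TangentSpace (endModel E) p) :
    TangentSpace 𝓘(ℝ, E) p.1 →L[ℝ] TangentSpace 𝓘(ℝ, E) p.1 :=
  fibrePart ξ + (christoffel nabla p.1 (horizontalPart ξ) ∘L p.2
    - p.2 ∘L christoffel nabla p.1 (horizontalPart ξ))

/-- The tangent space of `J(M)` at `p = ⟨x, j⟩`: the linearization `j ∘ a + a ∘ j = 0` of `j² = -1`,
where `a` is the fibre component of `ξ`. -/
def twistorTangent (p : EndTM E M) : Submodule ℝ (TangentSpace (endModel E) p) where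
  carrier := {ξ | p.2 ∘L fibrePart ξ + fibrePart ξ ∘L p.2 = 0}
  add_mem' := fun {ξ η} hξ hη => by
    have h : fibrePart (ξ + η) = fibrePart ξ + fibrePart η := rfl
    simp only [Set.mem_ofPred_eq, h, ContinuousLinearMap.comp_add, ContinuousLinearMap.add_comp]
      at hξ hη ⊢
    rw [add_add_add_comm, hξ, hη, add_zero]
  zero_mem' := by
    have h : fibrePart (0 : TangentSpace (endModel E) p) = 0 := rfl
    simp [h]
  smul_mem' := fun c ξ hξ => by
    have h : fibrePart (c • ξ) = c • fibrePart ξ := rfl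
    simp only [Set.mem_ofPred_eq, h, ContinuousLinearMap.comp_smul, ContinuousLinearMap.smul_comp]
      at hξ ⊢
    rw [← smul_add, hξ, smul_zero]

/-- The almost complex structure `J^∇` of `J(M)`. At `p = ⟨x, j⟩` it is determined by
`dπ(J^∇ ξ) = j(dπ ξ)` and `(π*∇ 𝒥)(J^∇ ξ) = j ∘ (π*∇ 𝒥)(ξ)`. -/
def twistorJ (p : EndTM E M) (ξ : TangentSpace (endModel E) p) : TangentSpace (endModel E) p :=
  show E × (E →L[ℝ] E) from
    (p.2 (horizontalPart ξ),
      p.2 ∘L nablaTaut nabla p ξ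
        - (christoffel nabla p.1 (p.2 (horizontalPart ξ)) ∘L p.2
          - p.2 ∘L christoffel nabla p.1 (p.2 (horizontalPart ξ))))

/-- The equations that characterize `J^∇`. -/
theorem twistorJ_unique (p : EndTM E M) (ξ η : TangentSpace (endModel E) p) :
    η = twistorJ nabla p ξ ↔
      mfderiv (endModel E) 𝓘(ℝ, E) (TotalSpace.proj : EndTM E M → M) p η
          = p.2 (mfderiv (endModel E) 𝓘(ℝ, E) (TotalSpace.proj : EndTM E M → M) p ξ) ∧
        nablaTaut nabla p η = p.2 ∘L nablaTaut nabla p ξ := by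
  rw [mfderiv_proj_eq, mfderiv_proj_eq]
  constructor
  · rintro rfl
    refine ⟨rfl, ?_⟩
    exact sub_add_cancel _ _
  · rintro ⟨h₁, h₂⟩
    refine Prod.ext h₁ ?_
    change fibrePart η = _ - (christoffel nabla p.1 (p.2 (horizontalPart ξ)) ∘L p.2
          - p.2 ∘L christoffel nabla p.1 (p.2 (horizontalPart ξ)))
    rw [← h₂, ← h₁]
    exact (add_sub_cancel_right _ _).symm

/-- `J^∇` is integrable on `J(M)`. -/
def TwistorIntegrable : Prop :=
  IsIntegrableOn (endModel E) (twistorSpace E M) twistorTangent (twistorJ nabla)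

end TwistorWeyl

end

/-!
The proof reduces the integrability of `J^∇` to an algebraic condition on the curvature, and then
solves that condition pointwise.

In the chart of `End(TM)` induced by a chart of `M` around `x`, the twistor space is the set
`j² = -1` in `E × End E` and `J^∇` is the explicit map `modelJ` built from the Christoffel symbols
`K` (`chartDeriv_twistorJ`). The point of this step is that `fibrePart` and `christoffel` refer to
the preferred chart around the base point itself, so the chart changes from one point to the next;
the inhomogeneous transformation law of the Christoffel symbols (`mfderiv_frameTransition`) makes
the covariant differential of the tautological section independent of the chart
(`chartDeriv_snd`). As `∇` is torsion-free, `K` is symmetric, and a computation with differentials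
along curves in `j² = -1` shows that the Nijenhuis tensor of `J^∇` is vertical and depends only on
the horizontal parts `u`, `v` of its arguments: at `j` it is, up to sign,
`[R(ju, jv) - R(u, v), j] - j [R(ju, v) + R(u, jv), j]` (`nijenhuis_modelJ`, `nijenhuis_twistorJ`).
Since every horizontal part occurs (`exists_twistor_field`), `J^∇` is integrable if and only if this
expression, the `typeObstruction`, vanishes for all `x`, all complex structures `j` of `T_x M` and
all `u`, `v`.

It remains to see that this holds if and only if `W = 0` (`forall_typeObstruction_eq_zero_iff`).
The tensors `[Q ∧ Id]` have zero obstruction, so the obstruction of `R` is that of `W`, and `W = 0`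
is sufficient. Conversely, let the obstruction of `W` vanish for every `j`, and insert the complex
structures `j = s B + s⁻¹ C`, with `B² = C² = 0` and `BC + CB = -1`. If `B u = B v = 0`, the leading
term for `s → ∞` gives `B (W(u, v) u) = 0`. If `u`, `v` and `y = W(u, v) u` were independent,
one could choose `B` with `B y = u ≠ 0`. Hence `W(u, v) u` lies in the span of `u` and `v`, and
an algebraic curvature tensor with this property and vanishing Ricci form is zero
(`eq_zero_of_forall_exists_eq_smul_add`).
-/

noncomputable section

namespace TwistorWeyl

/-! ### Algebraic curvature tensors and complex structures -/

section Algebra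

variable {V : Type*} [AddCommGroup V] [Module ℝ V]

/-- The obstruction `([R(ju, jv) - R(u, v), j] - j [R(ju, v) + R(u, jv), j]) z`, for a tensor `R`
of curvature type and a complex structure `j`. It vanishes for all `u`, `v`, `z` if and only if
`R(u, v)` preserves the space of vectors of type `(1, 0)` whenever `u` and `v` are of
type `(1, 0)`. -/
def typeObstruction (R : V → V → V → V) (j : V → V) (u v z : V) : V :=
  (R (j u) (j v) (j z) - j (R (j u) (j v) z)) - (R u v (j z) - j (R u v z))
    - j (R (j u) v (j z) - j (R (j u) v z)) - j (R u (j v) (j z) - j (R u (j v) z))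

theorem typeObstruction_wedgeId (Q : V →ₗ[ℝ] V →ₗ[ℝ] ℝ) {j : V →ₗ[ℝ] V}
    (hj : ∀ w, j (j w) = -w) (u v z : V) :
    typeObstruction (wedgeId fun a b => Q a b) j u v z = 0 := by
  simp only [typeObstruction, wedgeId, map_add, map_sub, map_neg, map_smul, hj]
  module

/-- An endomorphism `T` with `T z ∈ span {z, u}` for all `z` is a homothety modulo `u`. -/
theorem exists_eq_smul_add_smulRight {T : V →ₗ[ℝ] V} {u : V} (hu : u ≠ 0)
    (hT : ∀ z, ∃ c d : ℝ, T z = c • z + d • u) :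
    ∃ (a : ℝ) (φ : V →ₗ[ℝ] ℝ), ∀ z, T z = a • z + φ z • u := by
  have hle : Submodule.span ℝ {u} ≤ (Submodule.span ℝ {u}).comap T := by
    rw [Submodule.span_singleton_le_iff_mem, Submodule.mem_comap]
    obtain ⟨c, d, h⟩ := hT u
    rw [h, ← add_smul]
    exact Submodule.smul_mem _ _ (Submodule.mem_span_singleton_self u)
  obtain ⟨a, ha⟩ := LinearMap.exists_eq_smul_id_of_forall_notLinearIndependent
    (f := (Submodule.span ℝ {u}).mapQ _ T hle) (fun z hz => by
      obtain ⟨z, rfl⟩ := Submodule.mkQ_surjective _ z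
      obtain ⟨c, d, h⟩ := hT z
      rw [LinearIndependent.pair_iff] at hz
      have h0 : (Submodule.span ℝ {u}).mkQ u = 0 := by
        simp [Submodule.mem_span_singleton_self]
      have := hz c (-1) (by
        rw [Submodule.mkQ_apply, Submodule.mapQ_apply, h]
        simp only [Submodule.mkQ_apply] at h0
        simp [h0])
      simp at this)
  obtain ⟨f, hf⟩ := Projective.exists_dual_ne_zero ℝ hu
  refine ⟨a, (f u)⁻¹ • f ∘ₗ (T - a • LinearMap.id), fun z => ?_⟩
  have hz : T z - a • z ∈ Submodule.span ℝ {u} := by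
    have := congrArg (fun g => g (Submodule.Quotient.mk z)) ha
    simp only [Submodule.mapQ_apply, LinearMap.smul_apply, Module.End.one_apply,
      ← Submodule.Quotient.mk_smul] at this
    exact (Submodule.Quotient.eq _).1 this
  obtain ⟨c, hc⟩ := Submodule.mem_span_singleton.1 hz
  have : (f u)⁻¹ * f (T z - a • z) = c := by
    rw [← hc, map_smul, smul_eq_mul]; field_simp
  simp only [LinearMap.smul_apply, LinearMap.comp_apply, LinearMap.sub_apply, LinearMap.id_apply,
    smul_eq_mul, this]
  rw [hc]; abel

theorem trace_eq_of_forall_eq_smul_add [FiniteDimensional ℝ V] {T : V →ₗ[ℝ] V} {u : V} {a : ℝ}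
    {φ : V →ₗ[ℝ] ℝ} (h : ∀ z, T z = a • z + φ z • u) :
    LinearMap.trace ℝ V T = a * finrank ℝ V + φ u := by
  have : T = a • LinearMap.id + φ.smulRight u := by
    ext z; simp [h]
  rw [this, map_add, map_smul, LinearMap.trace_id, LinearMap.trace_smulRight, smul_eq_mul]

/-- A Ricci-flat algebraic curvature tensor `R` with `R(u, v)u ∈ span {u, v}` for all `u`, `v`
vanishes. -/
theorem eq_zero_of_forall_exists_eq_smul_add [FiniteDimensional ℝ V] (hn : 2 ≤ finrank ℝ V)
    {R : V →ₗ[ℝ] V →ₗ[ℝ] V →ₗ[ℝ] V} (hskew : ∀ u v w, R u v w = -R v u w)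
    (hbianchi : ∀ u v w, R u v w + R v w u + R w u v = 0)
    (hricci : ∀ u v, LinearMap.trace ℝ V ((R u).flip v) = 0)
    (hR : ∀ u v, ∃ c d : ℝ, R u v u = c • v + d • u) (u v w : V) : R u v w = 0 := by
  have hn' : (2 : ℝ) ≤ finrank ℝ V := by exact_mod_cast hn
  have hself : ∀ u w, R u u w = 0 := fun u w => by
    have := hskew u u w
    have h2 : (2 : ℝ) • R u u w = 0 := by linear_combination (norm := module) this
    exact (smul_eq_zero.1 h2).resolve_left two_ne_zero
  -- The homothety part of `z ↦ R(u, z)u` is zero: this map kills `u` and has trace zero.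
  have key1 : ∀ u v, ∃ c : ℝ, R u v u = c • u := by
    intro u v
    by_cases hu : u = 0
    · exact ⟨0, by simp [hu]⟩
    obtain ⟨a, φ, h⟩ := exists_eq_smul_add_smulRight (T := (R u).flip u) hu fun z => by
      simpa using hR u z
    have htr := trace_eq_of_forall_eq_smul_add h
    rw [hricci] at htr
    have h1 := h u
    rw [LinearMap.flip_apply, hself, ← add_smul, eq_comm, smul_eq_zero_iff_left hu] at h1
    have ha : a = 0 := by nlinarith
    exact ⟨φ v, by have := h v; rwa [ha, zero_smul, zero_add] at this⟩
  -- The same argument applies to `z ↦ R(u, v)z + R(z, v)u`, the polarization of `u ↦ R(u, v)u`,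
  -- whose trace is zero by the Bianchi identity.
  have key2 : ∀ u v, R u v u = 0 := by
    intro u v
    by_cases hu : u = 0
    · simp [hu]
    obtain ⟨α, hα⟩ := key1 u v
    have hG : ∀ z (c1 c3 : ℝ), R (u + z) v (u + z) = c1 • (u + z) → R z v z = c3 • z →
        R u v z + R z v u = (c1 - c3) • z + (c1 - α) • u := by
      intro z c1 c3 h1 h3
      simp only [map_add, LinearMap.add_apply, hα, h3] at h1
      linear_combination (norm := module) h1
    obtain ⟨a, φ, h⟩ := exists_eq_smul_add_smulRight (T := R u v + (R.flip v).flip u) hu fun z => by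
      obtain ⟨c1, h1⟩ := key1 (u + z) v
      obtain ⟨c3, h3⟩ := key1 z v
      exact ⟨_, _, hG z c1 c3 h1 h3⟩
    have htr := trace_eq_of_forall_eq_smul_add h
    have e1 : R u v = (R u).flip v - (R v).flip u := by
      ext z
      have := hbianchi u v z
      rw [hskew z u v] at this
      simp only [LinearMap.sub_apply, LinearMap.flip_apply]
      linear_combination (norm := module) this
    have e2 : (R.flip v).flip u = -(R v).flip u := by
      ext z
      simpa using hskew z v u
    rw [map_add, e2, e1, map_neg, map_sub, hricci, hricci] at htr
    have h1 := h u
    simp only [LinearMap.add_apply, LinearMap.flip_apply, hα] at h1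
    have h2 : α + α = a + φ u := by
      rw [← add_smul, ← add_smul] at h1
      exact smul_left_injective ℝ hu h1
    have hlin : ∃ z, LinearIndependent ℝ ![u, z] := by
      by_contra! hcon
      have : (⊤ : Submodule ℝ V) ≤ Submodule.span ℝ {u} := by
        intro z _
        by_contra hz
        refine hcon z ?_
        rw [LinearIndependent.pair_iff' hu]
        intro c hc
        exact hz (Submodule.mem_span_singleton.2 ⟨c, hc⟩)
      have h' := Submodule.finrank_mono this
      rw [finrank_top, finrank_span_singleton hu] at h'
      omega
    obtain ⟨z, hz⟩ := hlin
    rw [LinearIndependent.pair_iff] at hz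
    have hz' : ∀ c d c' d' : ℝ, c • z + d • u = c' • z + d' • u → c = c' ∧ d = d' := by
      intro c d c' d' h
      have := hz (d - d') (c - c') (by linear_combination (norm := module) h)
      exact ⟨sub_eq_zero.1 this.2, sub_eq_zero.1 this.1⟩
    -- Comparing the values at `z` and at `-z` gives `α = a`.
    obtain ⟨c1, k1⟩ := key1 (u + z) v
    obtain ⟨c2, k2⟩ := key1 (u + -z) v
    obtain ⟨c3, k3⟩ := key1 z v
    have g1 := hG z c1 c3 k1 k3
    have g2 := hG (-z) c2 (-c3) k2 (by simp [k3])
    have f1 := h z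
    have f2 := h (-z)
    simp only [LinearMap.add_apply, LinearMap.flip_apply, smul_neg, map_neg] at f1 f2 g2
    rw [g1] at f1
    simp only [LinearMap.neg_apply] at g2
    rw [neg_add, g2] at f2
    obtain ⟨p1, p2⟩ := hz' _ _ _ _ f1
    obtain ⟨p3, p4⟩ := hz' (-(c2 - -c3)) (c2 - α) (-a) (-φ z)
      (by linear_combination (norm := module) f2)
    have ha : α = a := by linarith
    have : α = 0 := by
      subst ha
      have : α * (finrank ℝ V + 1) = 0 := by linarith
      rcases mul_eq_zero.1 this with h | h
      · exact h
      · linarith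
    rw [hα, this, zero_smul]
  -- Now `R` is also skew in the first and third argument, so the three terms of the Bianchi
  -- identity are equal.
  have hpol : ∀ u v z, R u v z + R z v u = 0 := by
    intro u v z
    have := key2 (u + z) v
    simp only [map_add, LinearMap.add_apply, key2] at this
    linear_combination (norm := module) this
  have h3 : (3 : ℝ) • R u v w = 0 := by
    linear_combination (norm := module) hbianchi u v w - hskew v w u + hpol u v w - hpol w u v
      + hskew v u w
  exact (smul_eq_zero.1 h3).resolve_left (by norm_num)

/-- For independent vectors `u`, `v`, `y` of an even-dimensional space there are `B`, `C` such that
`s B + s⁻¹ C` is a complex structure for all `s ≠ 0`, `B` kills `u` and `v`, and `B y = u`. -/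
theorem exists_pencil_complexStructure [FiniteDimensional ℝ V] (hn : Even (finrank ℝ V)) {u v y : V}
    (h : LinearIndependent ℝ ![u, y, v]) :
    ∃ B C : V →ₗ[ℝ] V, (∀ w, B (B w) = 0) ∧ (∀ w, C (C w) = 0) ∧
      (∀ w, B (C w) + C (B w) = -w) ∧ B u = 0 ∧ B v = 0 ∧ B y = u := by
  obtain ⟨m, hm⟩ := hn
  -- Extend `u`, `y`, `v` to a basis indexed by `Fin m × Fin 2`, in which they have the indices
  -- `(0, 0)`, `(0, 1)` and `(1, 0)`; then put `B e₁ = e₀`, `C e₀ = -e₁` on each pair `(e₀, e₁)`.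
  let b0 := Basis.sumExtend h
  have : Finite (Fin 3 ⊕ Basis.sumExtendIndex h) := Module.Finite.finite_basis b0
  have : Finite (Basis.sumExtendIndex h) := Finite.of_injective (Sum.inr (α := Fin 3))
    Sum.inr_injective
  have := Fintype.ofFinite (Basis.sumExtendIndex h)
  obtain ⟨k, hk⟩ : ∃ k, Fintype.card (Basis.sumExtendIndex h) = k := ⟨_, rfl⟩
  have hcard : 3 + k = m * 2 := by
    have := Module.finrank_eq_card_basis b0
    simp only [Fintype.card_sum, Fintype.card_fin, hk] at this
    omega
  have hm2 : 2 ≤ m := by omega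
  let e : Fin 3 ⊕ Basis.sumExtendIndex h ≃ Fin m × Fin 2 :=
    ((Equiv.refl _).sumCongr (Fintype.equivFinOfCardEq hk)).trans
      (finSumFinEquiv.trans ((finCongr hcard).trans finProdFinEquiv.symm))
  let b := b0.reindex e
  have hb : ∀ i : Fin 3, b (e (Sum.inl i)) = ![u, y, v] i := by
    intro i
    simp only [b, Basis.reindex_apply, Equiv.symm_apply_apply, b0]
    simp only [Basis.sumExtend, Basis.reindex_apply, Basis.extend_apply_self]
    rfl
  have hu : b (⟨0, by omega⟩, 0) = u := by
    rw [← show e (Sum.inl 0) = (⟨0, by omega⟩, 0) by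
      simp [e, finProdFinEquiv, Fin.divNat, Fin.modNat]]
    exact hb 0
  have hy : b (⟨0, by omega⟩, 1) = y := by
    rw [← show e (Sum.inl 1) = (⟨0, by omega⟩, 1) by
      simp [e, finProdFinEquiv, Fin.divNat, Fin.modNat]]
    exact hb 1
  have hv : b (⟨1, by omega⟩, 0) = v := by
    rw [← show e (Sum.inl 2) = (⟨1, by omega⟩, 0) by
      simp [e, finProdFinEquiv, Fin.divNat, Fin.modNat]]
    exact hb 2
  let B : V →ₗ[ℝ] V := b.constr ℝ fun p => if p.2 = 0 then 0 else b (p.1, 0)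
  let C : V →ₗ[ℝ] V := b.constr ℝ fun p => if p.2 = 0 then -b (p.1, 1) else 0
  have hB0 : ∀ i, B (b (i, 0)) = 0 := fun i => (b.constr_basis ℝ _ _).trans (by simp)
  have hB1 : ∀ i, B (b (i, 1)) = b (i, 0) := fun i => (b.constr_basis ℝ _ _).trans (by simp)
  have hC0 : ∀ i, C (b (i, 0)) = -b (i, 1) := fun i => (b.constr_basis ℝ _ _).trans (by simp)
  have hC1 : ∀ i, C (b (i, 1)) = 0 := fun i => (b.constr_basis ℝ _ _).trans (by simp)
  have ext : ∀ f g : V →ₗ[ℝ] V, (∀ i, f (b (i, 0)) = g (b (i, 0))) →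
      (∀ i, f (b (i, 1)) = g (b (i, 1))) → ∀ w, f w = g w := by
    intro f g h0 h1 w
    have : f = g := b.ext fun ⟨i, k⟩ => by
      fin_cases k
      · exact h0 i
      · exact h1 i
    rw [this]
  refine ⟨B, C, ext (B ∘ₗ B) 0 ?_ ?_, ext (C ∘ₗ C) 0 ?_ ?_,
    ext (B ∘ₗ C + C ∘ₗ B) (-LinearMap.id) ?_ ?_, ?_, ?_, ?_⟩
  · simp [hB0]
  · simp [hB0, hB1]
  · simp [hC0, hC1]
  · simp [hC1]
  · simp [hB0, hB1, hC0]
  · simp [hB1, hC0, hC1]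
  · rw [← hu, hB0]
  · rw [← hv, hB0]
  · rw [← hy, hB1, hu]

/-- The leading coefficient, for `s → ∞`, of the obstruction at `(u, v, u)` for the complex
structures `s B + s⁻¹ C` with `B u = B v = 0` is `B (R(u, v) u)`. -/
theorem apply_eq_zero_of_typeObstruction_eq_zero {R : V →ₗ[ℝ] V →ₗ[ℝ] V →ₗ[ℝ] V}
    (hR : ∀ j : V →ₗ[ℝ] V, (∀ w, j (j w) = -w) →
      ∀ u v z, typeObstruction (fun a b c => R a b c) j u v z = 0)
    {B C : V →ₗ[ℝ] V} (hB : ∀ w, B (B w) = 0) (hC : ∀ w, C (C w) = 0)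
    (hBC : ∀ w, B (C w) + C (B w) = -w) {u v : V} (hu : B u = 0) (hv : B v = 0) :
    B (R u v u) = 0 := by
  -- The obstruction at `s = t⁻¹`, multiplied by `t`.
  have key : ∀ t : ℝ, t ≠ 0 → B (R u v u) + (t ^ 2) • (-(B (R (C u) (C v) u)) - R u v (C u)
      + C (R u v u) - B (R (C u) v (C u)) - R (C u) v u - B (R u (C v) (C u)) - R u (C v) u)
      + (t ^ 4) • (R (C u) (C v) (C u) - C (R (C u) (C v) u) - C (R (C u) v (C u))
      - C (R u (C v) (C u))) = 0 := by
    intro t ht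
    have hj : ∀ w, (t⁻¹ • B + t • C) ((t⁻¹ • B + t • C) w) = -w := by
      intro w
      simp only [LinearMap.add_apply, LinearMap.smul_apply, map_add, map_smul, hB, hC, smul_zero,
        zero_add, add_zero, smul_smul, mul_inv_cancel₀ ht, inv_mul_cancel₀ ht, one_smul]
      rw [add_comm, ← hBC w]
    have hju : (t⁻¹ • B + t • C) u = t • C u := by simp [hu]
    have hjv : (t⁻¹ • B + t • C) v = t • C v := by simp [hv]
    have := hR _ hj u v u
    simp only [typeObstruction, map_sub, hj, hju, hjv] at this
    simp only [LinearMap.add_apply, LinearMap.smul_apply, map_smul] at this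
    have h2 := congrArg (fun w => t • w) this
    simp only [smul_zero] at h2
    linear_combination (norm := skip) h2
    match_scalars <;> field_simp <;> ring
  -- These weights isolate the constant term of `a₀ + a₂ t² + a₄ t⁴` from the values at `1, 2, 3`.
  linear_combination (norm := module) (3 / 2 : ℝ) • key 1 (by norm_num)
    - (3 / 5 : ℝ) • key 2 (by norm_num) + (1 / 10 : ℝ) • key 3 (by norm_num)

/-- The Ricci form `(u, v) ↦ Tr(z ↦ R(u, z)v)` of a tensor of curvature type. -/
def ricciForm (R : V →ₗ[ℝ] V →ₗ[ℝ] V →ₗ[ℝ] V) : V →ₗ[ℝ] V →ₗ[ℝ] ℝ :=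
  LinearMap.mk₂ ℝ (fun u v => LinearMap.trace ℝ V ((R u).flip v))
    (fun u u' v => by
      rw [← map_add]; congr 1; ext z; simp)
    (fun c u v => by
      rw [← map_smul]; congr 1; ext z; simp)
    (fun u v v' => by
      rw [← map_add]; congr 1; ext z; simp)
    (fun c u v => by
      rw [← map_smul]; congr 1; ext z; simp)

theorem ricciForm_apply (R : V →ₗ[ℝ] V →ₗ[ℝ] V →ₗ[ℝ] V) (u v : V) :
    ricciForm R u v = LinearMap.trace ℝ V ((R u).flip v) := rfl

/-- The bilinear form `Q` with `W = R + [Q ∧ Id]`: the symmetric and the skew part of the Ricci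
form, scaled by `1/(n-1)` and `1/(n+1)`, respectively. -/
def schoutenForm (R : V →ₗ[ℝ] V →ₗ[ℝ] V →ₗ[ℝ] V) : V →ₗ[ℝ] V →ₗ[ℝ] ℝ :=
  (1 / ((finrank ℝ V : ℝ) - 1)) • (1 / 2 : ℝ) • (ricciForm R + (ricciForm R).flip)
    + (1 / ((finrank ℝ V : ℝ) + 1)) • (1 / 2 : ℝ) • (ricciForm R - (ricciForm R).flip)

/-- The tensor `[Q ∧ Id]` as a trilinear map. -/
def wedgeIdₗ (Q : V →ₗ[ℝ] V →ₗ[ℝ] ℝ) : V →ₗ[ℝ] V →ₗ[ℝ] V →ₗ[ℝ] V :=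
  LinearMap.mk₂ ℝ (fun u v => -(Q u v • LinearMap.id + (Q u).smulRight v)
      + (Q v u • LinearMap.id + (Q v).smulRight u))
    (fun _ _ _ => by ext; simp; module)
    (fun _ _ _ => by ext; simp; module)
    (fun _ _ _ => by ext; simp; module)
    (fun _ _ _ => by ext; simp; module)

theorem wedgeIdₗ_apply (Q : V →ₗ[ℝ] V →ₗ[ℝ] ℝ) (u v w : V) :
    wedgeIdₗ Q u v w = wedgeId (fun a b => Q a b) u v w := by
  simp [wedgeIdₗ, wedgeId]

/-- The Ricci form of `[Q ∧ Id]` is `-(n-1)Q` for symmetric `Q` and `-(n+1)Q` for skew `Q`. -/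
theorem trace_wedgeIdₗ [FiniteDimensional ℝ V] (Q : V →ₗ[ℝ] V →ₗ[ℝ] ℝ) (u v : V) :
    LinearMap.trace ℝ V ((wedgeIdₗ Q u).flip v) = Q v u - finrank ℝ V * Q u v := by
  have : (wedgeIdₗ Q u).flip v = -(Q u).smulRight v - Q u v • LinearMap.id
      + (Q.flip u).smulRight v + (Q.flip v).smulRight u := by
    ext z
    simp [wedgeIdₗ_apply, wedgeId]
    abel
  rw [this]
  simp [LinearMap.trace_smulRight]
  ring

/-- The algebraic form of the theorem: a curvature tensor with the first Bianchi identity has zero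
type obstruction for every complex structure if and only if its Weyl component vanishes. -/
theorem forall_typeObstruction_eq_zero_iff [FiniteDimensional ℝ V] (hn : Even (finrank ℝ V))
    {R : V →ₗ[ℝ] V →ₗ[ℝ] V →ₗ[ℝ] V} (hskew : ∀ u v w, R u v w = -R v u w)
    (hbianchi : ∀ u v w, R u v w + R v w u + R w u v = 0) :
    (∀ j : V →ₗ[ℝ] V, (∀ w, j (j w) = -w) →
      ∀ u v z, typeObstruction (fun a b c => R a b c) j u v z = 0) ↔
    ∀ u v w, R u v w + wedgeId (fun a b => schoutenForm R a b) u v w = 0 := by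
  constructor
  · intro hR
    rcases Nat.eq_zero_or_pos (finrank ℝ V) with h0 | hpos
    · have := finrank_zero_iff.1 h0
      exact fun _ _ _ => Subsingleton.elim _ _
    have h2 : 2 ≤ finrank ℝ V := by
      obtain ⟨m, hm⟩ := hn
      omega
    have hn' : (2 : ℝ) ≤ finrank ℝ V := by exact_mod_cast h2
    have hW : ∀ u v w, (R + wedgeIdₗ (schoutenForm R)) u v w
        = R u v w + wedgeId (fun a b => schoutenForm R a b) u v w := by
      intro u v w
      simp [wedgeIdₗ_apply]
    have hobs : ∀ j : V →ₗ[ℝ] V, (∀ w, j (j w) = -w) → ∀ u v z, typeObstruction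
        (fun a b c => (R + wedgeIdₗ (schoutenForm R)) a b c) j u v z = 0 := by
      intro j hj u v z
      have h1 := hR j hj u v z
      have h2 := typeObstruction_wedgeId (schoutenForm R) hj u v z
      simp only [hW]
      simp only [typeObstruction, map_add, map_sub] at h1 h2 ⊢
      linear_combination (norm := module) h1 + h2
    intro u v w
    rw [← hW]
    refine eq_zero_of_forall_exists_eq_smul_add h2 (fun u v w => ?_) (fun u v w => ?_)
      (fun u v => ?_) (fun u v => ?_) u v w
    · rw [hW, hW, hskew u v w]
      simp only [wedgeId]
      abel
    · simp only [hW, wedgeId]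
      linear_combination (norm := module) hbianchi u v w
    · have : ((R + wedgeIdₗ (schoutenForm R)) u).flip v
          = (R u).flip v + (wedgeIdₗ (schoutenForm R) u).flip v := by
        ext; simp
      rw [this, map_add, trace_wedgeIdₗ, ← ricciForm_apply]
      simp only [schoutenForm, LinearMap.add_apply, LinearMap.sub_apply, LinearMap.smul_apply,
        LinearMap.flip_apply, smul_eq_mul]
      have e1 : (finrank ℝ V : ℝ) - 1 ≠ 0 := by linarith
      have e2 : (finrank ℝ V : ℝ) + 1 ≠ 0 := by linarith
      field_simp
      ring
    · -- Otherwise `u`, `v`, `y = W(u, v)u` are independent, and some `B` with `B u = B v = 0`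
      -- has `B y ≠ 0`.
      by_contra hcon
      set y := (R + wedgeIdₗ (schoutenForm R)) u v u with hy
      have hself : (R + wedgeIdₗ (schoutenForm R)) u u u = 0 := by
        rw [hW]
        have h2 : (2 : ℝ) • R u u u = 0 := by
          linear_combination (norm := module) hskew u u u
        rw [(smul_eq_zero.1 h2).resolve_left two_ne_zero]
        simp only [wedgeId]
        abel
      have hu : u ≠ 0 := fun h => hcon ⟨0, 0, by simp [hy, h]⟩
      have hli : LinearIndependent ℝ ![u, y, v] := by
        rw [Fintype.linearIndependent_iff]
        intro g hg
        simp only [Fin.sum_univ_three, Matrix.cons_val_zero, Matrix.cons_val_one,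
          Matrix.cons_val] at hg
        have g1 : g 1 = 0 := by
          by_contra hg1
          refine hcon ⟨-(g 1)⁻¹ * g 2, -(g 1)⁻¹ * g 0, ?_⟩
          have : y = (g 1)⁻¹ • g 1 • y := by rw [smul_smul, inv_mul_cancel₀ hg1, one_smul]
          rw [this]
          linear_combination (norm := module) (g 1)⁻¹ • hg
        have g2 : g 2 = 0 := by
          by_contra hg2
          refine hcon ⟨0, 0, ?_⟩
          have : v = (-(g 2)⁻¹ * g 0) • u := by
            have : v = (g 2)⁻¹ • g 2 • v := by rw [smul_smul, inv_mul_cancel₀ hg2, one_smul]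
            rw [g1] at hg
            rw [this]
            linear_combination (norm := module) (g 2)⁻¹ • hg
          rw [hy, this, map_smul, LinearMap.smul_apply, hself]
          simp
        have g0 : g 0 = 0 := by
          rw [g1, g2] at hg
          simpa [hu] using hg
        intro i
        fin_cases i
        exacts [g0, g1, g2]
      obtain ⟨B, C, hB, hC, hBC, hBu, hBv, hBy⟩ := exists_pencil_complexStructure hn hli
      have := apply_eq_zero_of_typeObstruction_eq_zero hobs hB hC hBC hBu hBv
      rw [← hy, hBy] at this
      exact hu this
  · intro hW j hj u v z
    have h := typeObstruction_wedgeId (schoutenForm R) hj u v z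
    have hR : ∀ u v w, R u v w = -wedgeId (fun a b => schoutenForm R a b) u v w :=
      fun u v w => eq_neg_of_add_eq_zero_left (hW u v w)
    simp only [typeObstruction, hR, map_neg, map_sub] at h ⊢
    linear_combination (norm := module) -h

end Algebra

/-! ### The twistor almost complex structure of a connection on a vector space -/

section Model

variable {E : Type*} [NormedAddCommGroup E] [NormedSpace ℝ E]

/-- The almost complex structure `J^∇` on `E × End E`, for the connection on `E` with Christoffel
operators `K x v ∈ End E`, so that `j(v, a) = (j v, j (a + [K v, j]) - [K (j v), j])`. -/
def modelJ (K : E → E →L[ℝ] E →L[ℝ] E) (q ξ : E × (E →L[ℝ] E)) : E × (E →L[ℝ] E) :=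
  (q.2 ξ.1, q.2 * (ξ.2 + (K q.1 ξ.1 * q.2 - q.2 * K q.1 ξ.1))
    - (K q.1 (q.2 ξ.1) * q.2 - q.2 * K q.1 (q.2 ξ.1)))

/-- The twistor space `j² = -1` of a vector space. -/
def modelTwistor (E : Type*) [NormedAddCommGroup E] [NormedSpace ℝ E] : Set (E × (E →L[ℝ] E)) :=
  {q | q.2 * q.2 = -1}

/-- The tangent space of `modelTwistor E` at `q`. -/
def modelTangent (q : E × (E →L[ℝ] E)) : Set (E × (E →L[ℝ] E)) :=
  {ξ | q.2 * ξ.2 + ξ.2 * q.2 = 0}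

/-- The derivative of `t ↦ modelJ K q η` along a curve with `q = p`, `q' = ξ`, along which `η` has
derivative `η'`; here `K'` is the derivative of `K`. -/
def modelJDeriv (K : E → E →L[ℝ] E →L[ℝ] E) (K' : E →L[ℝ] E →L[ℝ] E →L[ℝ] E)
    (p ξ η η' : E × (E →L[ℝ] E)) : E × (E →L[ℝ] E) :=
  (ξ.2 η.1 + p.2 η'.1,
    ξ.2 * (η.2 + (K p.1 η.1 * p.2 - p.2 * K p.1 η.1))
      + p.2 * (η'.2 + (((K' ξ.1 η.1 + K p.1 η'.1) * p.2 + K p.1 η.1 * ξ.2)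
        - (ξ.2 * K p.1 η.1 + p.2 * (K' ξ.1 η.1 + K p.1 η'.1))))
      - (((K' ξ.1 (p.2 η.1) + K p.1 (ξ.2 η.1 + p.2 η'.1)) * p.2 + K p.1 (p.2 η.1) * ξ.2)
        - (ξ.2 * K p.1 (p.2 η.1) + p.2 * (K' ξ.1 (p.2 η.1) + K p.1 (ξ.2 η.1 + p.2 η'.1)))))

theorem clm_mul_apply (f g : E →L[ℝ] E) (x : E) : (f * g) x = f (g x) := rfl

set_option synthInstance.maxHeartbeats 200000 in
theorem hasDerivAt_modelJ {K : E → E →L[ℝ] E →L[ℝ] E} {K' : E →L[ℝ] E →L[ℝ] E →L[ℝ] E}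
    {q η : ℝ → E × (E →L[ℝ] E)} {ξ η' : E × (E →L[ℝ] E)} {t : ℝ} (hK : HasFDerivAt K K' (q t).1)
    (hq : HasDerivAt q ξ t) (hη : HasDerivAt η η' t) :
    HasDerivAt (fun s => modelJ K (q s) (η s)) (modelJDeriv K K' (q t) ξ (η t) η') t := by
  have hq1 : HasDerivAt (fun s => (q s).1) ξ.1 t :=
    (hasFDerivAt_fst (𝕜 := ℝ) (p := q t)).comp_hasDerivAt t hq
  have hq2 : HasDerivAt (fun s => (q s).2) ξ.2 t :=
    (hasFDerivAt_snd (𝕜 := ℝ) (p := q t)).comp_hasDerivAt t hq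
  have hη1 : HasDerivAt (fun s => (η s).1) η'.1 t :=
    (hasFDerivAt_fst (𝕜 := ℝ) (p := η t)).comp_hasDerivAt t hη
  have hη2 : HasDerivAt (fun s => (η s).2) η'.2 t :=
    (hasFDerivAt_snd (𝕜 := ℝ) (p := η t)).comp_hasDerivAt t hη
  have hKq : HasDerivAt (fun s => K (q s).1) (K' ξ.1) t :=
    HasFDerivAt.comp_hasDerivAt (f := fun s => (q s).1) (l := K) t hK hq1
  have hjv := hq2.clm_apply hη1
  have hKv := hKq.clm_apply hη1
  have hKjv := hKq.clm_apply hjv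
  exact hjv.prodMk ((hq2.mul (hη2.add ((hKv.mul hq2).sub (hq2.mul hKv)))).sub
    ((hKjv.mul hq2).sub (hq2.mul hKjv)))

theorem modelJ_mem_modelTangent (K : E → E →L[ℝ] E →L[ℝ] E) {q ξ : E × (E →L[ℝ] E)}
    (hq : q ∈ modelTwistor E) (hξ : ξ ∈ modelTangent q) : modelJ K q ξ ∈ modelTangent q := by
  have hj : ∀ x, q.2 (q.2 x) = -x := fun x => congrArg (fun g : E →L[ℝ] E => g x) hq
  have ha : ∀ x, ξ.2 (q.2 x) = -q.2 (ξ.2 x) := fun x =>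
    eq_neg_of_add_eq_zero_right (congrArg (fun g : E →L[ℝ] E => g x) hξ)
  change _ = _
  ext z
  simp only [modelJ, add_apply, clm_mul_apply,
    sub_apply, map_add, map_sub, map_neg, hj, ha,
    zero_apply]
  abel

/-- Every tangent vector of the twistor space is the velocity of a curve in it: `j` is moved by
the conjugations with `exp (t b)`, where `b = j a / 2` has `[b, j] = a`. -/
theorem exists_curve_of_mem_modelTangent [CompleteSpace E] {p ξ : E × (E →L[ℝ] E)}
    (hp : p ∈ modelTwistor E) (hξ : ξ ∈ modelTangent p) :
    ∃ γ : ℝ → E × (E →L[ℝ] E), γ 0 = p ∧ HasDerivAt γ ξ 0 ∧ ∀ t, γ t ∈ modelTwistor E := by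
  obtain ⟨x, j⟩ := p
  obtain ⟨v, a⟩ := ξ
  change j * j = -1 at hp
  change j * a + a * j = 0 at hξ
  set b : E →L[ℝ] E := (1 / 2 : ℝ) • (j * a) with hb
  let _ : NormedAlgebra ℚ (E →L[ℝ] E) := NormedAlgebra.restrictScalars ℚ ℝ _
  have hexp : ∀ t : ℝ, NormedSpace.exp (t • (-b)) * NormedSpace.exp (t • b) = 1 := by
    intro t
    rw [← NormedSpace.exp_add_of_commute, smul_neg, neg_add_cancel, NormedSpace.exp_zero]
    rw [smul_neg]
    exact (Commute.refl _).neg_left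
  refine ⟨fun t => (x + t • v, NormedSpace.exp (t • b) * j * NormedSpace.exp (t • (-b))),
    ?_, ?_, ?_⟩
  · simp
  · have h1 := hasDerivAt_exp_smul_const (𝕂 := ℝ) b (0 : ℝ)
    have h2 := hasDerivAt_exp_smul_const (𝕂 := ℝ) (-b) (0 : ℝ)
    have h3 := (h1.mul_const j).mul h2
    have h4 : HasDerivAt (fun t : ℝ => x + t • v) v 0 := by
      simpa using ((hasDerivAt_id (0 : ℝ)).smul_const v).const_add x
    refine (h4.prodMk h3).congr_deriv ?_
    refine Prod.ext rfl ?_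
    simp only [zero_smul, NormedSpace.exp_zero, one_mul, mul_one, hb]
    have e1 : j * a * j = a := by
      have : a * j = -(j * a) := eq_neg_of_add_eq_zero_right hξ
      rw [mul_assoc, this, mul_neg, ← mul_assoc, hp]; simp
    have e2 : j * (j * a) = -a := by rw [← mul_assoc, hp]; simp
    rw [smul_mul_assoc, e1, mul_neg, mul_smul_comm, e2]
    module
  · intro t
    change NormedSpace.exp (t • b) * j * NormedSpace.exp (t • (-b))
      * (NormedSpace.exp (t • b) * j * NormedSpace.exp (t • (-b))) = -1
    have h' : NormedSpace.exp (t • b) * NormedSpace.exp (t • (-b)) = 1 := by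
      rw [← NormedSpace.exp_add_of_commute, smul_neg, add_neg_cancel, NormedSpace.exp_zero]
      rw [smul_neg]
      exact (Commute.refl _).neg_right
    calc _ = NormedSpace.exp (t • b) * j * (NormedSpace.exp (t • (-b)) * NormedSpace.exp (t • b))
          * j * NormedSpace.exp (t • (-b)) := by simp only [mul_assoc]
      _ = -1 := by rw [hexp, mul_one, mul_assoc _ j j, hp, mul_neg_one, neg_mul, h']

/-- The derivative of a field that represents `J X` on the twistor space. Differentiating along
curves in the twistor space makes the values of the fields elsewhere irrelevant. -/
theorem fderiv_eq_modelJDeriv [CompleteSpace E] {K : E → E →L[ℝ] E →L[ℝ] E}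
    {K' : E →L[ℝ] E →L[ℝ] E →L[ℝ] E} {p ξ : E × (E →L[ℝ] E)} (hK : HasFDerivAt K K' p.1)
    (hp : p ∈ modelTwistor E) (hξ : ξ ∈ modelTangent p)
    {X X' : E × (E →L[ℝ] E) → E × (E →L[ℝ] E)}
    (hX : DifferentiableAt ℝ X p) (hX' : DifferentiableAt ℝ X' p)
    (h : ∀ᶠ q in 𝓝[modelTwistor E] p, X' q = modelJ K q (X q)) :
    fderiv ℝ X' p ξ = modelJDeriv K K' p ξ (X p) (fderiv ℝ X p ξ) := by
  obtain ⟨γ, h0, hγ, hmem⟩ := exists_curve_of_mem_modelTangent hp hξ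
  subst h0
  have hlim : Tendsto γ (𝓝 0) (𝓝[modelTwistor E] (γ 0)) :=
    tendsto_nhdsWithin_iff.2 ⟨hγ.continuousAt, Eventually.of_forall hmem⟩
  have h1 := hX'.hasFDerivAt.comp_hasDerivAt (0 : ℝ) hγ
  have h2 := hasDerivAt_modelJ hK hγ (hX.hasFDerivAt.comp_hasDerivAt (0 : ℝ) hγ)
  exact h1.unique (h2.congr_of_eventuallyEq (hlim.eventually h))

/-- The curvature of the connection with Christoffel operators `K`, whose derivative is `K'`. -/
def modelCurvature (K : E →L[ℝ] E →L[ℝ] E) (K' : E →L[ℝ] E →L[ℝ] E →L[ℝ] E) (u v w : E) : E :=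
  K' u v w - K' v u w + K u (K v w) - K v (K u w)

/-- The Nijenhuis tensor at `p`, with the differentials of `X'` and `Y'` replaced by `modelJDeriv`.
Here `η`, `θ` are the values of `X`, `Y` at `p`, and `η₁`, `η₂`, `θ₁`, `θ₂` are the derivatives of
`X` along `Y'`, of `X` along `Y`, of `Y` along `X'` and of `Y` along `X`; they cancel. -/
theorem nijenhuis_algebra {K : E → E →L[ℝ] E →L[ℝ] E}
    {K' : E →L[ℝ] E →L[ℝ] E →L[ℝ] E} {p η θ η₁ η₂ θ₁ θ₂ : E × (E →L[ℝ] E)}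
    (hsymm : ∀ u v, K p.1 u v = K p.1 v u)
    (hp : p ∈ modelTwistor E) (hη : η ∈ modelTangent p) (hθ : θ ∈ modelTangent p) :
    ((modelJDeriv K K' p (modelJ K p η) θ θ₁ - modelJDeriv K K' p (modelJ K p θ) η η₁)
      - modelJ K p (θ₁ - modelJDeriv K K' p θ η η₂)
      - modelJ K p (modelJDeriv K K' p η θ θ₂ - η₁)
      - (θ₂ - η₂)).1 = 0 ∧
    ∀ z, ((modelJDeriv K K' p (modelJ K p η) θ θ₁ - modelJDeriv K K' p (modelJ K p θ) η η₁)
      - modelJ K p (θ₁ - modelJDeriv K K' p θ η η₂)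
      - modelJ K p (modelJDeriv K K' p η θ θ₂ - η₁)
      - (θ₂ - η₂)).2 z = -typeObstruction (modelCurvature (K p.1) K') p.2 η.1 θ.1 z := by
  obtain ⟨x, j⟩ := p
  obtain ⟨v, a⟩ := η
  obtain ⟨w, c⟩ := θ
  obtain ⟨v₁, a₁⟩ := η₁
  obtain ⟨w₁, c₁⟩ := θ₁
  obtain ⟨v₂, a₂⟩ := η₂
  obtain ⟨w₂, c₂⟩ := θ₂
  have hj : ∀ x, j (j x) = -x := fun x => congrArg (fun g : E →L[ℝ] E => g x) hp
  have ha : ∀ x, a (j x) = -j (a x) := fun x =>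
    eq_neg_of_add_eq_zero_right (congrArg (fun g : E →L[ℝ] E => g x) hη)
  have hc : ∀ x, c (j x) = -j (c x) := fun x =>
    eq_neg_of_add_eq_zero_right (congrArg (fun g : E →L[ℝ] E => g x) hθ)
  simp only at hsymm ⊢
  have s1 := hsymm w v
  have s2 := hsymm w (j v)
  have s3 := hsymm (j w) v
  have s4 := hsymm (j w) (j v)
  constructor
  · simp only [modelJDeriv, modelJ, Prod.fst_sub, add_apply,
      clm_mul_apply, sub_apply,
      map_add, map_sub, map_neg, hj, s1, s2, s3, s4]
    abel
  · intro z
    simp only [typeObstruction, modelCurvature, modelJDeriv, modelJ, Prod.fst_sub, Prod.snd_sub,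
      add_apply,
      clm_mul_apply, sub_apply,
      neg_apply, map_add, map_sub, map_neg, hj, ha, hc, s1, s2, s3, s4]
    abel

/-- The Nijenhuis tensor of the twistor almost complex structure is vertical, and its vertical
component is the type obstruction of the curvature at the horizontal components. -/
theorem nijenhuis_modelJ [CompleteSpace E] {K : E → E →L[ℝ] E →L[ℝ] E}
    {K' : E →L[ℝ] E →L[ℝ] E →L[ℝ] E} {p : E × (E →L[ℝ] E)} (hK : HasFDerivAt K K' p.1)
    (hsymm : ∀ u v, K p.1 u v = K p.1 v u) (hp : p ∈ modelTwistor E)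
    {X Y X' Y' : E × (E →L[ℝ] E) → E × (E →L[ℝ] E)}
    (hX : DifferentiableAt ℝ X p) (hX' : DifferentiableAt ℝ X' p)
    (hY : DifferentiableAt ℝ Y p) (hY' : DifferentiableAt ℝ Y' p)
    (hXX' : ∀ᶠ q in 𝓝[modelTwistor E] p, X q ∈ modelTangent q ∧ X' q = modelJ K q (X q))
    (hYY' : ∀ᶠ q in 𝓝[modelTwistor E] p, Y q ∈ modelTangent q ∧ Y' q = modelJ K q (Y q)) :
    (lieBracket ℝ X' Y' p - modelJ K p (lieBracket ℝ X' Y p)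
      - modelJ K p (lieBracket ℝ X Y' p) - lieBracket ℝ X Y p).1 = 0 ∧
    ∀ z, (lieBracket ℝ X' Y' p - modelJ K p (lieBracket ℝ X' Y p)
      - modelJ K p (lieBracket ℝ X Y' p) - lieBracket ℝ X Y p).2 z
      = -typeObstruction (modelCurvature (K p.1) K') p.2 (X p).1 (Y p).1 z := by
  obtain ⟨hXT, hXJ⟩ := hXX'.self_of_nhdsWithin hp
  obtain ⟨hYT, hYJ⟩ := hYY'.self_of_nhdsWithin hp
  have dX : ∀ ξ ∈ modelTangent p, fderiv ℝ X' p ξ = _ := fun ξ hξ =>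
    fderiv_eq_modelJDeriv hK hp hξ hX hX' (hXX'.mono fun _ h => h.2)
  have dY : ∀ ξ ∈ modelTangent p, fderiv ℝ Y' p ξ = _ := fun ξ hξ =>
    fderiv_eq_modelJDeriv hK hp hξ hY hY' (hYY'.mono fun _ h => h.2)
  have hXT' : X' p ∈ modelTangent p := hXJ ▸ modelJ_mem_modelTangent K hp hXT
  have hYT' : Y' p ∈ modelTangent p := hYJ ▸ modelJ_mem_modelTangent K hp hYT
  simp only [lieBracket, dX _ hYT, dX _ hYT', dY _ hXT, dY _ hXT']
  rw [hXJ, hYJ]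
  exact nijenhuis_algebra hsymm hp hXT hYT

end Model

/-! ### Coordinate frames and Christoffel symbols -/

section Frame

variable {E : Type*} [NormedAddCommGroup E] [NormedSpace ℝ E]
  {M : Type*} [TopologicalSpace M] [ChartedSpace E M] [IsManifold 𝓘(ℝ, E) ∞ M]

/-- The coordinate frame of the preferred chart around `x₀`, as a map `E → T_y M`. It is zero for
`y` outside the chart domain. -/
def frame (x₀ y : M) : E →L[ℝ] TangentSpace 𝓘(ℝ, E) y :=
  (trivializationAt E (TangentSpace 𝓘(ℝ, E)) x₀).symmL ℝ y

/-- The inverse `T_y M → E` of the coordinate frame of the preferred chart around `x₀`. -/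
def coframe (x₀ y : M) : TangentSpace 𝓘(ℝ, E) y →L[ℝ] E :=
  (trivializationAt E (TangentSpace 𝓘(ℝ, E)) x₀).continuousLinearMapAt ℝ y

theorem frame_coframe {x₀ y : M} (hy : y ∈ (chartAt E x₀).source) (v : TangentSpace 𝓘(ℝ, E) y) :
    frame x₀ y (coframe x₀ y v) = v :=
  Trivialization.symmL_continuousLinearMapAt _ hy v

theorem coframe_frame {x₀ y : M} (hy : y ∈ (chartAt E x₀).source) (v : E) :
    coframe x₀ y (frame x₀ y v) = v :=
  Trivialization.continuousLinearMapAt_symmL _ hy v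

theorem coframe_eq_mfderiv {x₀ y : M} (hy : y ∈ (chartAt E x₀).source) :
    coframe x₀ y = mfderiv 𝓘(ℝ, E) 𝓘(ℝ, E) (extChartAt 𝓘(ℝ, E) x₀) y :=
  TangentBundle.continuousLinearMapAt_trivializationAt hy

theorem coframe_self (x : M) (v : TangentSpace 𝓘(ℝ, E) x) : coframe x x v = v := by
  rw [coframe_eq_mfderiv (mem_chart_source E x), mfderiv_extChartAt_self]
  rfl

theorem frame_self (x : M) (v : E) : frame x x v = v := by
  rw [← coframe_self x (frame x x v)]
  exact coframe_frame (mem_chart_source E x) v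

theorem extend_eq_frame {x y : M} (hy : y ∈ (chartAt E x).source) (v : TangentSpace 𝓘(ℝ, E) x) :
    extend E v y = frame (E := E) x y v := by
  have h : (trivializationAt E (TangentSpace 𝓘(ℝ, E)) x (TotalSpace.mk' E x v)).2 = (v : E) :=
    ((trivializationAt E (TangentSpace 𝓘(ℝ, E)) x).continuousLinearMapAt_apply_of_mem (R := ℝ)
      (mem_chart_source E x) v).symm.trans (coframe_self x v)
  refine .trans ?_ ((trivializationAt E (TangentSpace 𝓘(ℝ, E)) x).symmL_apply (R := ℝ)
    hy (v : E)).symm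
  exact congrArg ((trivializationAt E (TangentSpace 𝓘(ℝ, E)) x).symm y) h

theorem trivialization_frame {x₀ y : M} (hy : y ∈ (chartAt E x₀).source) (v : E) :
    (trivializationAt E (TangentSpace 𝓘(ℝ, E)) x₀ ⟨y, frame x₀ y v⟩).2 = v :=
  (Trivialization.continuousLinearMapAt_apply_of_mem (R := ℝ) _ hy _).symm.trans
    (coframe_frame hy v)

theorem contMDiffAt_frame {x₀ y : M} (hy : y ∈ (chartAt E x₀).source) {k : ℕ∞} {f : M → E}
    (hf : ContMDiffAt 𝓘(ℝ, E) 𝓘(ℝ, E) k f y) :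
    ContMDiffAt 𝓘(ℝ, E) (𝓘(ℝ, E).prod 𝓘(ℝ, E)) k
      (fun z => TotalSpace.mk' E z (frame x₀ z (f z))) y := by
  rw [(trivializationAt E (TangentSpace 𝓘(ℝ, E)) x₀).contMDiffAt_section_iff hy]
  refine hf.congr_of_eventuallyEq ?_
  filter_upwards [(chartAt E x₀).open_source.mem_nhds hy] with z hz
  exact trivialization_frame hz _

theorem mdifferentiableAt_frame {x₀ y : M} (hy : y ∈ (chartAt E x₀).source) {f : M → E}
    (hf : MDifferentiableAt 𝓘(ℝ, E) 𝓘(ℝ, E) f y) :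
    MDifferentiableAt 𝓘(ℝ, E) (𝓘(ℝ, E).prod 𝓘(ℝ, E))
      (fun z => TotalSpace.mk' E z (frame x₀ z (f z))) y := by
  rw [(trivializationAt E (TangentSpace 𝓘(ℝ, E)) x₀).mdifferentiableAt_section_iff 𝓘(ℝ, E) _ hy]
  refine hf.congr_of_eventuallyEq ?_
  filter_upwards [(chartAt E x₀).open_source.mem_nhds hy] with z hz
  exact trivialization_frame hz _

theorem mdifferentiableAt_frame_const {x₀ y : M} (hy : y ∈ (chartAt E x₀).source) (w : E) :
    MDifferentiableAt 𝓘(ℝ, E) (𝓘(ℝ, E).prod 𝓘(ℝ, E))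
      (fun z => TotalSpace.mk' E z (frame x₀ z w)) y :=
  mdifferentiableAt_frame hy mdifferentiableAt_const

variable (nabla : Connection E M)

theorem nabla_sum {ι : Type*} (s : Finset ι) {y : M} {g : ι → M → ℝ}
    {g' : ι → TangentSpace 𝓘(ℝ, E) y →L[ℝ] ℝ} {σ : ι → ∀ z : M, TangentSpace 𝓘(ℝ, E) z}
    (hg : ∀ i, HasMFDerivAt 𝓘(ℝ, E) 𝓘(ℝ, ℝ) (g i) y (g' i))
    (hσ : ∀ i, MDifferentiableAt 𝓘(ℝ, E) (𝓘(ℝ, E).prod 𝓘(ℝ, E))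
      (fun z => TotalSpace.mk' E z (σ i z)) y) (v : TangentSpace 𝓘(ℝ, E) y) :
    nabla (fun z => ∑ i ∈ s, g i z • σ i z) y v
      = ∑ i ∈ s, (g i y • nabla (σ i) y v + g' i v • σ i y) := by
  classical
  induction s using Finset.induction_on with
  | empty =>
    have h : nabla (fun z => 0) y = 0 := congrFun nabla.zero y
    simp only [Finset.sum_empty]
    rw [h]
    rfl
  | insert i s hi ih =>
    have h1 := MDifferentiableAt.smul_section (hg i).mdifferentiableAt (hσ i)
    have h2 : MDifferentiableAt 𝓘(ℝ, E) (𝓘(ℝ, E).prod 𝓘(ℝ, E))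
      (fun z => TotalSpace.mk' E z (∑ i ∈ s, g i z • σ i z)) y :=
      MDifferentiableAt.sum_section fun i _ =>
        MDifferentiableAt.smul_section (hg i).mdifferentiableAt (hσ i)
    have h3 := nabla.isCovariantDerivativeOnUniv.add h1 h2 (Set.mem_univ y)
    have h4 := nabla.isCovariantDerivativeOnUniv.leibniz (hσ i) (hg i).mdifferentiableAt
      (Set.mem_univ y)
    simp only [Finset.sum_insert hi]
    rw [← ih]
    refine (congrArg (fun L => L v) h3).trans ?_
    rw [add_apply]
    congr 1
    refine (congrArg (fun L => L v) h4).trans ?_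
    rw [← (hg i).mfderiv]
    rfl

variable [FiniteDimensional ℝ E]

/-- The Christoffel symbols of `nabla` in the preferred chart around `x₀`: `christoffelCoord u w v`
represents `∇_v W` at the point with coordinate `u`, for the field `W` with constant coordinate
`w`. -/
def christoffelCoord (x₀ : M) (u : E) : E →L[ℝ] E →L[ℝ] E :=
  ∑ i, (LinearMap.toContinuousLinearMap ((finBasis ℝ E).coord i)).smulRight
    (coframe x₀ ((extChartAt 𝓘(ℝ, E) x₀).symm u) ∘L
      nabla (fun z => frame x₀ z (finBasis ℝ E i)) ((extChartAt 𝓘(ℝ, E) x₀).symm u) ∘L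
        frame x₀ ((extChartAt 𝓘(ℝ, E) x₀).symm u))

/-- The coordinate expression of a connection. -/
theorem nabla_frame {x₀ y : M} (hy : y ∈ (chartAt E x₀).source) {f : M → E}
    {f' : TangentSpace 𝓘(ℝ, E) y →L[ℝ] E} (hf : HasMFDerivAt 𝓘(ℝ, E) 𝓘(ℝ, E) f y f')
    (v : TangentSpace 𝓘(ℝ, E) y) :
    nabla (fun z => frame x₀ z (f z)) y v
      = frame x₀ y (f' v
        + christoffelCoord nabla x₀ (extChartAt 𝓘(ℝ, E) x₀ y) (f y) (coframe x₀ y v)) := by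
  set b := finBasis ℝ E
  let c : Fin (finrank ℝ E) → E →L[ℝ] ℝ := fun i => LinearMap.toContinuousLinearMap (b.coord i)
  have hsum : ∀ w, w = ∑ i, c i w • b i := fun w => (b.sum_repr w).symm
  have hg : ∀ i, HasMFDerivAt 𝓘(ℝ, E) 𝓘(ℝ, ℝ) (fun z => c i (f z)) y (c i ∘L f') := fun i =>
    (c i).hasMFDerivAt.comp y hf
  have h1 : (fun z => frame x₀ z (f z)) = fun z => ∑ i, c i (f z) • frame x₀ z (b i) := by
    funext z
    conv_lhs => rw [hsum (f z)]
    rw [map_sum]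
    simp only [map_smul]
  have h2 := nabla_sum nabla Finset.univ (g := fun i z => c i (f z))
    (σ := fun i z => frame x₀ z (b i)) hg (fun i => mdifferentiableAt_frame_const hy (b i)) v
  rw [h1, h2, Finset.sum_add_distrib, map_add, add_comm]
  congr 1
  · conv_rhs => rw [hsum (f' v)]
    rw [map_sum]
    refine Finset.sum_congr rfl fun i _ => ?_
    rw [map_smul]
    rfl
  · have hinv : (extChartAt 𝓘(ℝ, E) x₀).symm (extChartAt 𝓘(ℝ, E) x₀ y) = y :=
      (extChartAt 𝓘(ℝ, E) x₀).left_inv (by rwa [extChartAt_source])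
    unfold christoffelCoord
    rw [hinv, sum_apply, sum_apply, map_sum]
    refine Finset.sum_congr rfl fun i _ => ?_
    change _ = frame x₀ y (c i (f y) • coframe x₀ y (nabla (fun z => frame x₀ z (b i)) y
      (frame x₀ y (coframe x₀ y v))))
    rw [map_smul, frame_coframe hy, frame_coframe hy]

end Frame

section Christoffel

theorem contDiffAt_sum_smulRight {ι E F G : Type*} [Fintype ι] [NormedAddCommGroup E]
    [NormedSpace ℝ E] [NormedAddCommGroup F] [NormedSpace ℝ F] [NormedAddCommGroup G]
    [NormedSpace ℝ G] {k : ℕ∞ω} (c : ι → F →L[ℝ] ℝ) {g : ι → E → G} {x : E}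
    (hg : ∀ i, ContDiffAt ℝ k (g i) x) :
    ContDiffAt ℝ k (fun u => ∑ i, (c i).smulRight (g i u)) x :=
  ContDiffAt.sum fun i _ => contDiffAt_const.smulRight (hg i)

variable {E : Type*} [NormedAddCommGroup E] [NormedSpace ℝ E]
  {M : Type*} [TopologicalSpace M] [ChartedSpace E M] [IsManifold 𝓘(ℝ, E) ∞ M]

theorem contMDiffOn_frame (x₀ : M) (w : E) :
    ContMDiffOn 𝓘(ℝ, E) (𝓘(ℝ, E).prod 𝓘(ℝ, E)) ∞
      (fun z => TotalSpace.mk' E z (frame x₀ z w)) (chartAt E x₀).source :=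
  fun _ hz => (contMDiffAt_frame (k := ⊤) hz contMDiffAt_const).contMDiffWithinAt

variable [FiniteDimensional ℝ E] [T2Space M] (nabla : Connection E M)

theorem contMDiffAt_nabla_frame
    (hsmooth : CovariantDerivative.ContMDiffCovariantDerivative nabla ∞) (x₀ : M) (w : E) :
    ContMDiffAt 𝓘(ℝ, E) 𝓘(ℝ, E →L[ℝ] E) ∞
      (fun y => coframe x₀ y ∘L nabla (fun z => frame x₀ z w) y ∘L frame x₀ y) x₀ := by
  -- A bump function turns the locally smooth field into a global one with the same germ.
  let χ : SmoothBumpFunction 𝓘(ℝ, E) x₀ := Classical.arbitrary _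
  have h1 : ContMDiff 𝓘(ℝ, E) (𝓘(ℝ, E).prod 𝓘(ℝ, E)) ∞
      (fun z => TotalSpace.mk' E z (((χ : M → ℝ) • fun z => frame x₀ z w) z)) :=
    ContMDiffOn.smul_section_of_tsupport χ.contMDiff.contMDiffOn
      (chartAt E x₀).open_source χ.tsupport_subset_chartAt_source (contMDiffOn_frame x₀ w)
  have h2 := hsmooth.contMDiff.contMDiff (σ := (χ : M → ℝ) • fun z => frame x₀ z w)
    (h1.contMDiffOn)
  have h3 := ((contMDiffAt_hom_bundle _).1 (h2.contMDiffAt univ_mem (x := x₀))).2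
  refine h3.congr_of_eventuallyEq ?_
  filter_upwards [χ.eventuallyEq_one.eventuallyEq_nhds,
    (chartAt E x₀).open_source.mem_nhds (mem_chart_source E x₀)] with y hy hy'
  have h4 : nabla (fun z => frame x₀ z w) y = nabla ((χ : M → ℝ) • fun z => frame x₀ z w) y := by
    refine nabla.isCovariantDerivativeOnUniv.congr_of_eventuallyEq
      (mdifferentiableAt_frame_const hy' w)
      (h1.contMDiffAt.mdifferentiableAt (by simp)) univ_mem ?_
    filter_upwards [hy] with z hz
    rw [Pi.smul_apply', hz, Pi.one_apply, one_smul]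
  rw [h4]
  rfl

/-- The Christoffel symbols of a smooth connection are smooth at the centre of the chart. -/
theorem contDiffAt_christoffelCoord
    (hsmooth : CovariantDerivative.ContMDiffCovariantDerivative nabla ∞) (x₀ : M) :
    ContDiffAt ℝ ∞ (christoffelCoord nabla x₀) (extChartAt 𝓘(ℝ, E) x₀ x₀) := by
  have h : ∀ i, ContDiffAt ℝ ∞ (fun u =>
      coframe x₀ ((extChartAt 𝓘(ℝ, E) x₀).symm u) ∘L
      nabla (fun z => frame x₀ z (finBasis ℝ E i)) ((extChartAt 𝓘(ℝ, E) x₀).symm u) ∘L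
        frame x₀ ((extChartAt 𝓘(ℝ, E) x₀).symm u)) (extChartAt 𝓘(ℝ, E) x₀ x₀) := fun i => by
    have h1 := contMDiffAt_nabla_frame nabla hsmooth x₀ (finBasis ℝ E i)
    have h2 := (contMDiffOn_extChartAt_symm (I := 𝓘(ℝ, E)) (n := ∞) x₀).contMDiffAt
      (extChartAt_target_mem_nhds x₀)
    have h3 := ContMDiffAt.comp_of_eq h1 h2 (extChartAt_to_inv x₀)
    exact h3.contDiffAt
  exact contDiffAt_sum_smulRight _ h

omit [FiniteDimensional ℝ E] in
theorem mlieBracket_eq_lieBracket (V W : ∀ x : E, TangentSpace 𝓘(ℝ, E) x) :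
    mlieBracket 𝓘(ℝ, E) V W = lieBracket ℝ V W := by
  rw [← mlieBracketWithin_univ, mlieBracketWithin_eq_lieBracketWithin]
  exact lieBracketWithin_univ

omit [FiniteDimensional ℝ E] [T2Space M] in
/-- Coordinate fields commute. -/
theorem mlieBracket_frame [CompleteSpace E] {x₀ y : M} (hy : y ∈ (chartAt E x₀).source) (v w : E) :
    mlieBracket 𝓘(ℝ, E) (fun z => frame x₀ z v) (fun z => frame x₀ z w) y = 0 := by
  have h : ∀ v : E, (fun z => frame x₀ z v) =ᶠ[𝓝 y]
      mpullback 𝓘(ℝ, E) 𝓘(ℝ, E) (extChartAt 𝓘(ℝ, E) x₀) (fun _ => v) := fun v => by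
    filter_upwards [(chartAt E x₀).open_source.mem_nhds hy] with z hz
    have hz' : z ∈ (extChartAt 𝓘(ℝ, E) x₀).source := by rwa [extChartAt_source]
    have hi := isInvertible_mfderiv_extChartAt hz'
    refine (hi.inverse_apply_eq.2 ?_).symm
    exact (coframe_frame hz v).symm.trans (congrArg (fun L => L (frame x₀ z v))
      (coframe_eq_mfderiv hz))
  rw [(h v).mlieBracket_vectorField_eq (h w)]
  have : IsManifold 𝓘(ℝ, E) (minSmoothness ℝ 2) M := by
    rw [minSmoothness_of_isRCLikeNormedField]
    infer_instance
  have hc : ∀ v : E, MDifferentiableAt 𝓘(ℝ, E) 𝓘(ℝ, E).tangent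
      (fun z => (⟨z, v⟩ : TangentBundle 𝓘(ℝ, E) E)) (extChartAt 𝓘(ℝ, E) x₀ y) :=
    fun v => ContMDiffAt.mdifferentiableAt (n := 1)
      ((contMDiffAt_vectorSpace_iff_contDiffAt (V := fun _ => v)).2 contDiffAt_const) one_ne_zero
  have h2 := mpullback_mlieBracket (I := 𝓘(ℝ, E)) (I' := 𝓘(ℝ, E)) (f := extChartAt 𝓘(ℝ, E) x₀)
    (V := fun _ => v) (W := fun _ => w) (x₀ := y) (n := 2)
    (hc v) (hc w)
    (contMDiffAt_extChartAt' hy) (by simp)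
  have h3 : mlieBracket 𝓘(ℝ, E) (fun _ : E => v) (fun _ : E => w) = 0 := by
    refine (mlieBracket_eq_lieBracket _ _).trans (funext fun z => ?_)
    simp [lieBracket]
    rfl
  rw [← h2, h3, mpullback_zero]
  rfl

omit [T2Space M] in
/-- The Christoffel symbols of a torsion-free connection are symmetric. -/
theorem christoffelCoord_symm (htorsion : nabla.torsion = 0) {x₀ y : M}
    (hy : y ∈ (chartAt E x₀).source) (v w : E) :
    christoffelCoord nabla x₀ (extChartAt 𝓘(ℝ, E) x₀ y) v w
      = christoffelCoord nabla x₀ (extChartAt 𝓘(ℝ, E) x₀ y) w v := by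
  have h1 : ∀ v w : E, nabla (fun z => frame x₀ z w) y (frame x₀ y v)
      = frame x₀ y (christoffelCoord nabla x₀ (extChartAt 𝓘(ℝ, E) x₀ y) w v) := fun v w => by
    rw [nabla_frame nabla hy (hasMFDerivAt_const w y), coframe_frame hy]
    exact congrArg _ (zero_add _)
  have h2 := nabla.torsion_eq_zero_iff.1 htorsion
    (mdifferentiableAt_frame_const hy v) (mdifferentiableAt_frame_const hy w)
  have : CompleteSpace E := FiniteDimensional.complete ℝ E
  rw [mlieBracket_frame hy, h1, h1, sub_eq_zero] at h2
  rw [← coframe_frame hy (christoffelCoord nabla x₀ _ v w), ← h2, coframe_frame hy]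

end Christoffel

/-! ### The coordinate expression of the covariant differential of the tautological section -/

section Coordinates

variable {E : Type*} [NormedAddCommGroup E] [NormedSpace ℝ E]
  {M : Type*} [TopologicalSpace M] [ChartedSpace E M] [IsManifold 𝓘(ℝ, E) ∞ M]

/-- The fibre coordinate of a point of `End(TM)`: the matrix of the endomorphism in the coordinate
frame of the preferred chart around `x₀`. -/
def fibreCoord (x₀ : M) (q : EndTM E M) : E →L[ℝ] E :=
  coframe x₀ q.1 ∘L q.2 ∘L frame x₀ q.1

theorem extChartAt_endModel_apply (p₀ q : EndTM E M) :
    extChartAt (endModel E) p₀ q = (extChartAt 𝓘(ℝ, E) p₀.1 q.1, fibreCoord p₀.1 q) := by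
  rw [FiberBundle.extChartAt]
  rfl

theorem mem_chartAt_endTM_source {p₀ q : EndTM E M} :
    q ∈ (chartAt (ModelProd E (E →L[ℝ] E)) p₀).source ↔ q.1 ∈ (chartAt E p₀.1).source := by
  rw [← extChartAt_source (endModel E), FiberBundle.extChartAt]
  simp only [mfld_simps]
  exact ⟨fun h => h.1, fun h => ⟨h, h⟩⟩

/-- The differential at `q` of the preferred chart of `End(TM)` around `p₀`. -/
def chartDeriv (p₀ q : EndTM E M) : TangentSpace (endModel E) q →L[ℝ] E × (E →L[ℝ] E) :=
  mfderiv (endModel E) 𝓘(ℝ, E × (E →L[ℝ] E)) (extChartAt (endModel E) p₀) q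

theorem hasMFDerivAt_chart {p₀ q : EndTM E M} (hq : q.1 ∈ (chartAt E p₀.1).source) :
    HasMFDerivAt (endModel E) 𝓘(ℝ, E × (E →L[ℝ] E)) (extChartAt (endModel E) p₀) q
      (chartDeriv p₀ q) :=
  (mdifferentiableAt_extChartAt (mem_chartAt_endTM_source.2 hq)).hasMFDerivAt

theorem chartDeriv_self (q : EndTM E M) (ξ : TangentSpace (endModel E) q) :
    chartDeriv q q ξ = (horizontalPart ξ, fibrePart ξ) := by
  unfold chartDeriv
  rw [mfderiv_extChartAt_self]
  rfl

theorem hasMFDerivAt_fibreCoord {p₀ q : EndTM E M} (hq : q.1 ∈ (chartAt E p₀.1).source) :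
    HasMFDerivAt (endModel E) 𝓘(ℝ, E →L[ℝ] E) (fibreCoord p₀.1) q
      (ContinuousLinearMap.snd ℝ E (E →L[ℝ] E) ∘L chartDeriv p₀ q) := by
  have h := (ContinuousLinearMap.snd ℝ E (E →L[ℝ] E)).hasMFDerivAt.comp q (hasMFDerivAt_chart hq)
  refine h.congr_of_eventuallyEq (Eventually.of_forall fun z => ?_)
  rw [Function.comp_apply, extChartAt_endModel_apply]
  rfl

theorem hasMFDerivAt_proj (q : EndTM E M) :
    HasMFDerivAt (endModel E) 𝓘(ℝ, E) (TotalSpace.proj : EndTM E M → M) q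
      (mfderiv (endModel E) 𝓘(ℝ, E) (TotalSpace.proj : EndTM E M → M) q) :=
  ((contMDiff_proj (n := 1) (IB := 𝓘(ℝ, E)) (F := E →L[ℝ] E)
    (E := fun x : M => TangentSpace 𝓘(ℝ, E) x →L[ℝ] TangentSpace 𝓘(ℝ, E) x)).contMDiffAt
      |>.mdifferentiableAt one_ne_zero).hasMFDerivAt

theorem chartDeriv_fst [FiniteDimensional ℝ E] {p₀ q : EndTM E M}
    (hq : q.1 ∈ (chartAt E p₀.1).source) (ξ : TangentSpace (endModel E) q) :
    (chartDeriv p₀ q ξ).1 = coframe p₀.1 q.1 (horizontalPart ξ) := by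
  have h := (ContinuousLinearMap.fst ℝ E (E →L[ℝ] E)).hasMFDerivAt.comp q (hasMFDerivAt_chart hq)
  have h1 : HasMFDerivAt (endModel E) 𝓘(ℝ, E)
      (extChartAt 𝓘(ℝ, E) p₀.1 ∘ (TotalSpace.proj : EndTM E M → M)) q _ :=
    (mdifferentiableAt_extChartAt hq).hasMFDerivAt.comp q (hasMFDerivAt_proj q)
  have h2 := hasMFDerivAt_unique h (h1.congr_of_eventuallyEq (Eventually.of_forall fun z => ?_))
  · have h3 := congrArg (fun L => L ξ) h2
    refine Eq.trans h3 ?_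
    rw [← mfderiv_proj_eq, coframe_eq_mfderiv hq]
    rfl
  · rw [Function.comp_apply, extChartAt_endModel_apply]
    rfl

/-- The transition matrix at `z` from the coordinate frame around `y` to that around `x₀`. -/
def frameTransition (x₀ y z : M) : E →L[ℝ] E := coframe x₀ z ∘L frame y z

theorem frame_frameTransition {x₀ y z : M} (hz : z ∈ (chartAt E x₀).source) (w : E) :
    frame x₀ z (frameTransition (E := E) x₀ y z w) = frame y z w :=
  frame_coframe hz _

theorem mdifferentiableAt_frameTransition {x₀ y : M} (hy : y ∈ (chartAt E x₀).source) :
    MDifferentiableAt 𝓘(ℝ, E) 𝓘(ℝ, E →L[ℝ] E) (frameTransition (E := E) x₀ y) y := by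
  have h := (contMDiffAt_coordChangeL (n := 1) (IB := 𝓘(ℝ, E))
    (e := trivializationAt E (TangentSpace 𝓘(ℝ, E)) y)
    (e' := trivializationAt E (TangentSpace 𝓘(ℝ, E)) x₀)
    (mem_chart_source E y) hy).mdifferentiableAt one_ne_zero
  refine h.congr_of_eventuallyEq ?_
  filter_upwards [(chartAt E x₀).open_source.mem_nhds hy,
    (chartAt E y).open_source.mem_nhds (mem_chart_source E y)] with z hz hz'
  ext w
  refine .trans ?_ (Trivialization.coordChangeL_apply (R := ℝ) _ _ ⟨hz', hz⟩ w).symm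
  rw [← Trivialization.symmL_apply (R := ℝ) _ hz']
  exact Trivialization.continuousLinearMapAt_apply_of_mem (R := ℝ) _ hz _

omit [IsManifold 𝓘(ℝ, E) ∞ M] in
theorem hasMFDerivAt_apply {y : M} {f : M → E →L[ℝ] E}
    {f' : TangentSpace 𝓘(ℝ, E) y →L[ℝ] (E →L[ℝ] E)}
    (hf : HasMFDerivAt 𝓘(ℝ, E) 𝓘(ℝ, E →L[ℝ] E) f y f') (w : E) :
    HasMFDerivAt 𝓘(ℝ, E) 𝓘(ℝ, E) (fun z => f z w) y (ContinuousLinearMap.apply ℝ E w ∘L f') :=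
  (ContinuousLinearMap.apply ℝ E w).hasMFDerivAt.comp y hf

/-- The transformation law of the Christoffel symbols. -/
theorem mfderiv_frameTransition [FiniteDimensional ℝ E] {nabla : Connection E M}
    (htorsion : nabla.torsion = 0) {x₀ y : M}
    (hy : y ∈ (chartAt E x₀).source) {T' : TangentSpace 𝓘(ℝ, E) y →L[ℝ] (E →L[ℝ] E)}
    (hT : HasMFDerivAt 𝓘(ℝ, E) 𝓘(ℝ, E →L[ℝ] E) (frameTransition (E := E) x₀ y) y T')
    (v w : TangentSpace 𝓘(ℝ, E) y) :
    T' v w = coframe x₀ y (christoffel nabla y v w)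
      - christoffelCoord nabla x₀ (extChartAt 𝓘(ℝ, E) x₀ y) (coframe x₀ y v) (coframe x₀ y w) := by
  have hf := hasMFDerivAt_apply hT w
  have h1 : christoffel nabla y v w =
      nabla (fun z => frame x₀ z (frameTransition (E := E) x₀ y z w)) y v := by
    change nabla (extend E w) y v = _
    congr 1
    refine nabla.isCovariantDerivativeOnUniv.congr_of_eventuallyEq
      (mdifferentiableAt_extend 𝓘(ℝ, E) E _) ?_ univ_mem ?_
    · exact mdifferentiableAt_frame hy hf.mdifferentiableAt
    · filter_upwards [(chartAt E x₀).open_source.mem_nhds hy,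
        (chartAt E y).open_source.mem_nhds (mem_chart_source E y)] with z hz hz'
      rw [extend_eq_frame hz']
      exact (frame_frameTransition hz _).symm
  rw [h1, nabla_frame nabla hy hf, coframe_frame hy, eq_sub_iff_add_eq,
    christoffelCoord_symm nabla htorsion hy]
  have h2 : frameTransition (E := E) x₀ y y w = coframe x₀ y w := by
    unfold frameTransition
    exact congrArg (coframe x₀ y) (frame_self (E := E) y w)
  rw [h2]
  rfl

theorem fibreCoord_mul_frameTransition {x₀ y : M} {q : EndTM E M}
    (h₀ : q.1 ∈ (chartAt E x₀).source) (h : q.1 ∈ (chartAt E y).source) :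
    fibreCoord x₀ q * frameTransition (E := E) x₀ y q.1
      = frameTransition (E := E) x₀ y q.1 * fibreCoord y q := by
  ext w
  change coframe x₀ q.1 (q.2 (frame x₀ q.1 (coframe x₀ q.1 (frame y q.1 w))))
    = coframe x₀ q.1 (frame y q.1 (coframe y q.1 (q.2 (frame y q.1 w))))
  rw [frame_coframe h₀, frame_coframe h]

theorem frameTransition_self {x₀ y : M} (w : E) :
    frameTransition (E := E) x₀ y y w = coframe x₀ y w :=
  congrArg (coframe x₀ y) (frame_self (E := E) y w)

theorem fibreCoord_self (q : EndTM E M) (w : E) : fibreCoord q.1 q w = q.2 w :=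
  (coframe_self q.1 _).trans (congrArg q.2 (frame_self (E := E) q.1 w))

theorem fibreCoord_coframe {x₀ : M} {q : EndTM E M} (hq : q.1 ∈ (chartAt E x₀).source)
    (w : TangentSpace 𝓘(ℝ, E) q.1) :
    fibreCoord x₀ q (coframe x₀ q.1 w) = coframe x₀ q.1 (q.2 w) :=
  congrArg (fun w => coframe x₀ q.1 (q.2 w)) (frame_coframe hq w)

/-- The coordinate expression of the covariant differential of the tautological section. -/
theorem chartDeriv_snd [FiniteDimensional ℝ E] {nabla : Connection E M}
    (htorsion : nabla.torsion = 0) {p₀ q : EndTM E M} (hq : q.1 ∈ (chartAt E p₀.1).source)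
    (ξ : TangentSpace (endModel E) q) (w : TangentSpace 𝓘(ℝ, E) q.1) :
    let K := christoffelCoord nabla p₀.1 (extChartAt 𝓘(ℝ, E) p₀.1 q.1) (chartDeriv p₀ q ξ).1
    ((chartDeriv p₀ q ξ).2 + (K * fibreCoord p₀.1 q - fibreCoord p₀.1 q * K)) (coframe p₀.1 q.1 w)
      = coframe p₀.1 q.1 (nablaTaut nabla q ξ w) := by
  intro K
  -- Differentiate the relation between the fibre coordinates in the charts around `p₀` and `q`.
  have hT := (mdifferentiableAt_frameTransition hq).hasMFDerivAt
  have hTp := hT.comp q (hasMFDerivAt_proj q)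
  have hL := (hasMFDerivAt_fibreCoord hq).mul' hTp
  have hR := hTp.mul' (hasMFDerivAt_fibreCoord (p₀ := q) (q := q) (mem_chart_source E q.1))
  have hLR := hasMFDerivAt_unique hL (hR.congr_of_eventuallyEq ?_)
  · let T' : TangentSpace 𝓘(ℝ, E) q.1 →L[ℝ] (E →L[ℝ] E) :=
      mfderiv 𝓘(ℝ, E) 𝓘(ℝ, E →L[ℝ] E) (frameTransition (E := E) p₀.1 q.1) q.1
    have h1 : fibreCoord p₀.1 q (T' (horizontalPart ξ) w)
          + (chartDeriv p₀ q ξ).2 (frameTransition (E := E) p₀.1 q.1 q.1 w)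
        = frameTransition (E := E) p₀.1 q.1 q.1 ((chartDeriv q q ξ).2 w)
          + T' (horizontalPart ξ) (fibreCoord q.1 q w) := by
      have h1 := congrArg (fun L => (L ξ : E →L[ℝ] E) w) hLR
      rw [← mfderiv_proj_eq]
      exact h1
    have hK : K = christoffelCoord nabla p₀.1 (extChartAt 𝓘(ℝ, E) p₀.1 q.1)
      (coframe p₀.1 q.1 (horizontalPart ξ)) := by rw [← chartDeriv_fst hq]
    have h2 : ∀ w : TangentSpace 𝓘(ℝ, E) q.1, T' (horizontalPart ξ) w
        = coframe p₀.1 q.1 (christoffel nabla q.1 (horizontalPart ξ) w) - K (coframe p₀.1 q.1 w) :=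
      fun w => hK ▸ mfderiv_frameTransition htorsion hq hT _ _
    have h3 : fibreCoord p₀.1 q (coframe p₀.1 q.1 (christoffel nabla q.1 (horizontalPart ξ) w)
            - K (coframe p₀.1 q.1 w)) + (chartDeriv p₀ q ξ).2 (coframe p₀.1 q.1 w)
        = coframe p₀.1 q.1 (fibrePart ξ w)
          + (coframe p₀.1 q.1 (christoffel nabla q.1 (horizontalPart ξ) (q.2 w))
            - K (coframe p₀.1 q.1 (q.2 w))) := by
      rw [← h2 w, ← h2 (q.2 w)]
      refine Eq.trans (congrArg₂ (· + ·) rfl ?_) (h1.trans (congrArg₂ (· + ·) ?_ ?_))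
      · exact congrArg (chartDeriv p₀ q ξ).2 (frameTransition_self (E := E) w).symm
      · exact (congrArg (fun p => frameTransition (E := E) p₀.1 q.1 q.1 (p.2 w))
          (chartDeriv_self q ξ)).trans (frameTransition_self (E := E) (fibrePart ξ w))
      · exact congrArg (T' (horizontalPart ξ)) (fibreCoord_self q w)
    rw [map_sub, fibreCoord_coframe hq] at h3
    change (chartDeriv p₀ q ξ).2 (coframe p₀.1 q.1 w)
      + (K (fibreCoord p₀.1 q (coframe p₀.1 q.1 w)) - fibreCoord p₀.1 q (K (coframe p₀.1 q.1 w)))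
      = coframe p₀.1 q.1 (fibrePart ξ w + (christoffel nabla q.1 (horizontalPart ξ) (q.2 w)
        - q.2 (christoffel nabla q.1 (horizontalPart ξ) w)))
    rw [fibreCoord_coframe hq, map_add, map_sub]
    linear_combination (norm := module) h3
  · have hc := (FiberBundle.continuous_proj (E →L[ℝ] E)
      (fun x : M => TangentSpace 𝓘(ℝ, E) x →L[ℝ] TangentSpace 𝓘(ℝ, E) x)).continuousAt (x := q)
    filter_upwards [hc ((chartAt E p₀.1).open_source.mem_nhds hq),
      hc ((chartAt E q.1).open_source.mem_nhds (mem_chart_source E q.1))] with z hz hz'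
    exact fibreCoord_mul_frameTransition hz hz'

end Coordinates

/-! ### The almost complex structure in coordinates -/

section Transfer

variable {E : Type*} [NormedAddCommGroup E] [NormedSpace ℝ E]
  {M : Type*} [TopologicalSpace M] [ChartedSpace E M] [IsManifold 𝓘(ℝ, E) ∞ M]

theorem extChartAt_mem_modelTwistor {p₀ q : EndTM E M} (hq : q.1 ∈ (chartAt E p₀.1).source) :
    extChartAt (endModel E) p₀ q ∈ modelTwistor E ↔ q ∈ twistorSpace E M := by
  have key : ∀ w : TangentSpace 𝓘(ℝ, E) q.1, (fibreCoord p₀.1 q * fibreCoord p₀.1 q)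
      (coframe p₀.1 q.1 w) = coframe p₀.1 q.1 (q.2 (q.2 w)) := fun w => by
    rw [clm_mul_apply, fibreCoord_coframe hq, fibreCoord_coframe hq]
  rw [extChartAt_endModel_apply]
  constructor
  · intro h w
    have h1 : fibreCoord p₀.1 q * fibreCoord p₀.1 q = -1 := h
    have h2 := key w
    rw [h1] at h2
    rw [← frame_coframe hq (q.2 (q.2 w)), ← h2]
    change frame p₀.1 q.1 (-coframe p₀.1 q.1 w) = _
    rw [map_neg, frame_coframe hq]
  · intro h
    change fibreCoord p₀.1 q * fibreCoord p₀.1 q = -1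
    ext w
    have h2 := key (frame p₀.1 q.1 w)
    rw [h, coframe_frame hq, map_neg, coframe_frame hq] at h2
    exact h2

variable [FiniteDimensional ℝ E] {nabla : Connection E M}

/-- In the chart around `p₀`, the almost complex structure `J^∇` is `modelJ`. -/
theorem chartDeriv_twistorJ (htorsion : nabla.torsion = 0) {p₀ q : EndTM E M}
    (hq : q.1 ∈ (chartAt E p₀.1).source) (ξ : TangentSpace (endModel E) q) :
    chartDeriv p₀ q (twistorJ nabla q ξ)
      = modelJ (christoffelCoord nabla p₀.1) (extChartAt (endModel E) p₀ q)
        (chartDeriv p₀ q ξ) := by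
  have hJ := (twistorJ_unique nabla q ξ _).1 rfl
  rw [mfderiv_proj_eq, mfderiv_proj_eq] at hJ
  have h1 : (chartDeriv p₀ q (twistorJ nabla q ξ)).1 = fibreCoord p₀.1 q (chartDeriv p₀ q ξ).1 := by
    rw [chartDeriv_fst hq, chartDeriv_fst hq, hJ.1, fibreCoord_coframe hq]
  rw [extChartAt_endModel_apply]
  refine Prod.ext h1 ?_
  ext w
  have h2 := chartDeriv_snd htorsion hq (twistorJ nabla q ξ) (frame p₀.1 q.1 w)
  have h3 := chartDeriv_snd htorsion hq ξ (frame p₀.1 q.1 w)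
  simp only at h2 h3
  rw [hJ.2, ContinuousLinearMap.comp_apply, ← fibreCoord_coframe hq, ← h3, coframe_frame hq, h1]
    at h2
  exact eq_sub_of_add_eq h2

theorem chartDeriv_mem_modelTangent (htorsion : nabla.torsion = 0) {p₀ q : EndTM E M}
    (hq : q.1 ∈ (chartAt E p₀.1).source) (hqS : q ∈ twistorSpace E M)
    (ξ : TangentSpace (endModel E) q) :
    chartDeriv p₀ q ξ ∈ modelTangent (extChartAt (endModel E) p₀ q) ↔ ξ ∈ twistorTangent q := by
  have hS := (extChartAt_mem_modelTwistor hq).2 hqS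
  rw [extChartAt_endModel_apply] at hS ⊢
  set P := fibreCoord p₀.1 q
  set K := christoffelCoord nabla p₀.1 (extChartAt 𝓘(ℝ, E) p₀.1 q.1) (chartDeriv p₀ q ξ).1 with hK
  have hPP : P * P = -1 := hS
  have h1 : P * (chartDeriv p₀ q ξ).2 + (chartDeriv p₀ q ξ).2 * P
      = P * ((chartDeriv p₀ q ξ).2 + (K * P - P * K))
        + ((chartDeriv p₀ q ξ).2 + (K * P - P * K)) * P := by
    have : P * (K * P - P * K) + (K * P - P * K) * P = 0 := by
      linear_combination (norm := noncomm_ring) K * hPP - hPP * K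
    rw [mul_add, add_mul, add_add_add_comm, this, add_zero]
  have key : ∀ w : TangentSpace 𝓘(ℝ, E) q.1,
      (P * (chartDeriv p₀ q ξ).2 + (chartDeriv p₀ q ξ).2 * P) (coframe p₀.1 q.1 w)
      = coframe p₀.1 q.1 (q.2 (fibrePart ξ w) + fibrePart ξ (q.2 w)) := fun w => by
    rw [h1, add_apply, clm_mul_apply, clm_mul_apply, chartDeriv_snd htorsion hq ξ w,
      fibreCoord_coframe hq, fibreCoord_coframe hq, chartDeriv_snd htorsion hq ξ (q.2 w),
      ← map_add]
    congr 1
    change q.2 (fibrePart ξ w + (christoffel nabla q.1 (horizontalPart ξ) (q.2 w)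
        - q.2 (christoffel nabla q.1 (horizontalPart ξ) w)))
      + (fibrePart ξ (q.2 w) + (christoffel nabla q.1 (horizontalPart ξ) (q.2 (q.2 w))
        - q.2 (christoffel nabla q.1 (horizontalPart ξ) (q.2 w)))) = _
    rw [hqS w, map_add, map_sub, hqS, map_neg]
    abel
  constructor
  · intro h
    have h0 : P * (chartDeriv p₀ q ξ).2 + (chartDeriv p₀ q ξ).2 * P = 0 := h
    refine ContinuousLinearMap.ext fun w => ?_
    have h2 := key w
    rw [h0] at h2
    refine (frame_coframe hq _).symm.trans ((congrArg _ h2.symm).trans ?_)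
    exact map_zero _
  · intro h
    change P * (chartDeriv p₀ q ξ).2 + (chartDeriv p₀ q ξ).2 * P = 0
    have h0 : q.2 ∘L fibrePart ξ + fibrePart ξ ∘L q.2 = 0 := h
    ext w
    have h2 := key (frame p₀.1 q.1 w)
    rw [coframe_frame hq] at h2
    refine h2.trans ((congrArg (fun L => coframe p₀.1 q.1 (L (frame p₀.1 q.1 w))) h0).trans ?_)
    exact map_zero _

end Transfer

/-! ### Vector fields in coordinates -/

section Bracket

variable {E : Type*} [NormedAddCommGroup E] [NormedSpace ℝ E]
  {M : Type*} [TopologicalSpace M] [ChartedSpace E M] [IsManifold 𝓘(ℝ, E) ∞ M]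

/-- The coordinate expression of a vector field of `End(TM)` in the preferred chart around `p₀`. -/
def chartField (p₀ : EndTM E M) (X : ∀ q : EndTM E M, TangentSpace (endModel E) q)
    (u : E × (E →L[ℝ] E)) : E × (E →L[ℝ] E) :=
  chartDeriv p₀ ((extChartAt (endModel E) p₀).symm u) (X ((extChartAt (endModel E) p₀).symm u))

theorem mpullbackWithin_eq_chartField (p₀ : EndTM E M)
    (X : ∀ q : EndTM E M, TangentSpace (endModel E) q) {u : E × (E →L[ℝ] E)}
    (hu : u ∈ (extChartAt (endModel E) p₀).target) :
    mpullbackWithin 𝓘(ℝ, E × (E →L[ℝ] E)) (endModel E) (extChartAt (endModel E) p₀).symm X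
      (Set.range (endModel E)) u = chartField p₀ X u := by
  refine (isInvertible_mfderivWithin_extChartAt_symm hu).inverse_apply_eq.2 ?_
  exact (congrArg (fun L => L (X ((extChartAt (endModel E) p₀).symm u)))
    (mfderivWithin_extChartAt_symm_comp_mfderiv_extChartAt hu)).symm

theorem eventually_mpullbackWithin_eq_chartField (p₀ : EndTM E M)
    (X : ∀ q : EndTM E M, TangentSpace (endModel E) q) :
    mpullbackWithin 𝓘(ℝ, E × (E →L[ℝ] E)) (endModel E) (extChartAt (endModel E) p₀).symm X
      (Set.range (endModel E)) =ᶠ[𝓝 (extChartAt (endModel E) p₀ p₀)] chartField p₀ X :=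
  Filter.mem_of_superset (extChartAt_target_mem_nhds p₀)
    fun _ hu => mpullbackWithin_eq_chartField p₀ X hu

theorem contDiffAt_chartField [CompleteSpace E] {p₀ : EndTM E M}
    {X : ∀ q : EndTM E M, TangentSpace (endModel E) q}
    (hX : ContMDiffAt (endModel E) (endModel E).tangent ∞
      (fun q => (⟨q, X q⟩ : TangentBundle (endModel E) (EndTM E M))) p₀) :
    ContDiffAt ℝ ∞ (chartField p₀ X) (extChartAt (endModel E) p₀ p₀) := by
  have h := contMDiffWithinAt_mpullbackWithin_extChartAt_symm (n := ∞) (m := ∞)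
    hX.contMDiffWithinAt uniqueMDiffOn_univ (Set.mem_univ _) (by simp)
  rw [Set.preimage_univ, Set.inter_univ] at h
  have h1 := contMDiffWithinAt_vectorSpace_iff_contDiffWithinAt.1 h
  exact (h1.contDiffAt (extChartAt_target_mem_nhds p₀)).congr_of_eventuallyEq
    (eventually_mpullbackWithin_eq_chartField p₀ X).symm

theorem mlieBracket_eq_lieBracket_chartField (p₀ : EndTM E M)
    (X Y : ∀ q : EndTM E M, TangentSpace (endModel E) q) :
    mlieBracket (endModel E) X Y p₀
      = lieBracket ℝ (chartField p₀ X) (chartField p₀ Y) (extChartAt (endModel E) p₀ p₀) := by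
  rw [← mlieBracketWithin_univ, mlieBracketWithin_apply]
  refine (isInvertible_mfderiv_extChartAt (mem_extChartAt_source p₀)).inverse_apply_eq.2 ?_
  rw [mfderiv_extChartAt_self]
  have h : Set.range (endModel E) = Set.univ := ModelWithCorners.range_eq_univ _
  have hs : (extChartAt (endModel E) p₀).symm ⁻¹' Set.univ ∩ Set.range (endModel E) = Set.univ := by
    rw [h, Set.preimage_univ, Set.univ_inter]
  have key : ∀ (V W : E × (E →L[ℝ] E) → E × (E →L[ℝ] E)) (s : Set (E × (E →L[ℝ] E))),
      s = Set.univ → lieBracketWithin ℝ V W s = lieBracket ℝ V W := by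
    rintro V W _ rfl
    exact lieBracketWithin_univ
  exact (congrFun (key _ _ _ hs) _).trans
    ((eventually_mpullbackWithin_eq_chartField p₀ X).lieBracket_vectorField_eq
      (eventually_mpullbackWithin_eq_chartField p₀ Y))

/-- Every smooth field in coordinates comes from a smooth local vector field. -/
theorem exists_chartField_eq [CompleteSpace E] (p₀ : EndTM E M)
    {V : E × (E →L[ℝ] E) → E × (E →L[ℝ] E)}
    (hV : ContDiffAt ℝ ∞ V (extChartAt (endModel E) p₀ p₀)) :
    ∃ X : ∀ q : EndTM E M, TangentSpace (endModel E) q,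
      ContMDiffAt (endModel E) (endModel E).tangent ∞
        (fun q => (⟨q, X q⟩ : TangentBundle (endModel E) (EndTM E M))) p₀ ∧
      ∀ᶠ q in 𝓝 p₀, chartDeriv p₀ q (X q) = V (extChartAt (endModel E) p₀ q) := by
  refine ⟨mpullback (endModel E) 𝓘(ℝ, E × (E →L[ℝ] E)) (extChartAt (endModel E) p₀) V, ?_, ?_⟩
  · exact ContMDiffAt.mpullback_vectorField_preimage (n := ∞)
      (contMDiffAt_vectorSpace_iff_contDiffAt.2 hV) contMDiffAt_extChartAt
      (isInvertible_mfderiv_extChartAt (mem_extChartAt_source p₀)) (by simp)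
  · filter_upwards [extChartAt_source_mem_nhds (I := endModel E) p₀] with q hq
    exact ((isInvertible_mfderiv_extChartAt hq).inverse_apply_eq.1 rfl).symm

end Bracket

/-! ### The curvature in coordinates -/

section CurvatureCoord

theorem hasFDerivAt_clm_apply_const {E F G : Type*} [NormedAddCommGroup E] [NormedSpace ℝ E]
    [NormedAddCommGroup F] [NormedSpace ℝ F] [NormedAddCommGroup G] [NormedSpace ℝ G]
    {K : E → F →L[ℝ] G} {K' : E →L[ℝ] F →L[ℝ] G} {x : E} (hK : HasFDerivAt K K' x) (w : F) :
    HasFDerivAt (fun u => K u w) (ContinuousLinearMap.apply ℝ G w ∘L K') x :=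
  (ContinuousLinearMap.apply ℝ G w).hasFDerivAt.comp x hK

variable {E : Type*} [NormedAddCommGroup E] [NormedSpace ℝ E]
  {M : Type*} [TopologicalSpace M] [ChartedSpace E M] [IsManifold 𝓘(ℝ, E) ∞ M]

theorem extend_eventuallyEq_frame {x : M} (v : TangentSpace 𝓘(ℝ, E) x) :
    (extend E v : ∀ y : M, TangentSpace 𝓘(ℝ, E) y) =ᶠ[𝓝 x] fun y => frame (E := E) x y v := by
  filter_upwards [(chartAt E x).open_source.mem_nhds (mem_chart_source E x)] with y hy
  exact extend_eq_frame hy v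

variable [FiniteDimensional ℝ E]

theorem mlieBracket_extend {x : M} (u v : TangentSpace 𝓘(ℝ, E) x) :
    mlieBracket 𝓘(ℝ, E) (extend E u) (extend E v) x = 0 := by
  have : CompleteSpace E := FiniteDimensional.complete ℝ E
  refine ((extend_eventuallyEq_frame u).mlieBracket_vectorField_eq
    (extend_eventuallyEq_frame v)).trans ?_
  exact mlieBracket_frame (mem_chart_source E x) (u : E) (v : E)

variable {nabla : Connection E M}

theorem nabla_frame_const {x₀ y : M} (hy : y ∈ (chartAt E x₀).source) (w : E)
    (v : TangentSpace 𝓘(ℝ, E) y) :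
    nabla (fun z => frame x₀ z w) y v = frame x₀ y
      (christoffelCoord nabla x₀ (extChartAt 𝓘(ℝ, E) x₀ y) w (coframe x₀ y v)) := by
  rw [nabla_frame nabla hy (hasMFDerivAt_const w y)]
  exact congrArg _ (zero_add _)

omit [FiniteDimensional ℝ E] in
theorem hasFDerivAt_apply_apply {K : E → E →L[ℝ] E →L[ℝ] E} {K' : E →L[ℝ] E →L[ℝ] E →L[ℝ] E}
    {x : E} (hK : HasFDerivAt K K' x) (w v : E) :
    HasFDerivAt (fun u => K u w v)
      (ContinuousLinearMap.apply ℝ E v ∘L ContinuousLinearMap.apply ℝ (E →L[ℝ] E) w ∘L K') x :=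
  hasFDerivAt_clm_apply_const (hasFDerivAt_clm_apply_const hK w) v

/-- The second covariant derivative of coordinate fields at the centre of the chart. -/
theorem nabla_nabla_of_eventuallyEq {x : M} {K' : E →L[ℝ] E →L[ℝ] E →L[ℝ] E}
    (hK : HasFDerivAt (christoffelCoord nabla x) K' (extChartAt 𝓘(ℝ, E) x x))
    {V W : ∀ y : M, TangentSpace 𝓘(ℝ, E) y} {v w : E} (hV : V =ᶠ[𝓝 x] fun y => frame x y v)
    (hW : W =ᶠ[𝓝 x] fun y => frame x y w) (u : TangentSpace 𝓘(ℝ, E) x) :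
    nabla (fun y => nabla W y (V y)) x u
      = (K' u w v + christoffelCoord nabla x (extChartAt 𝓘(ℝ, E) x x)
        (christoffelCoord nabla x (extChartAt 𝓘(ℝ, E) x x) w v) u : E) := by
  have hx := mem_chart_source E x
  have hf := (hasFDerivAt_apply_apply hK w v).hasMFDerivAt.comp x
    (mdifferentiableAt_extChartAt hx).hasMFDerivAt
  have h1 : ∀ᶠ y in 𝓝 x, nabla W y (V y)
      = frame x y (christoffelCoord nabla x (extChartAt 𝓘(ℝ, E) x y) w v) := by
    filter_upwards [hW.eventuallyEq_nhds, hV,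
      (chartAt E x).open_source.mem_nhds hx] with y hw hv hy
    have hd := mdifferentiableAt_frame_const hy w
    have h2 : nabla W y = nabla (fun z => frame (E := E) x z w) y :=
      nabla.isCovariantDerivativeOnUniv.congr_of_eventuallyEq
        (hd.congr_of_eventuallyEq (hw.mono fun z hz => by
          change TotalSpace.mk' E z (W z) = _
          rw [hz])) hd univ_mem hw
    rw [h2, hv, nabla_frame_const hy, coframe_frame hy]
  have hd := mdifferentiableAt_frame hx hf.mdifferentiableAt
  rw [nabla.isCovariantDerivativeOnUniv.congr_of_eventuallyEq
    (hd.congr_of_eventuallyEq (h1.mono fun z hz => by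
      change TotalSpace.mk' E z (nabla W z (V z)) = _
      rw [hz]
      rfl)) hd univ_mem h1,
    nabla_frame nabla hx hf, frame_self, coframe_self, mfderiv_extChartAt_self]
  rfl

theorem christoffelCoord_deriv_symm (htorsion : nabla.torsion = 0) {x : M}
    {K' : E →L[ℝ] E →L[ℝ] E →L[ℝ] E}
    (hK : HasFDerivAt (christoffelCoord nabla x) K' (extChartAt 𝓘(ℝ, E) x x)) (u v w : E) :
    K' u v w = K' u w v := by
  have h1 := hasFDerivAt_apply_apply hK v w
  have h2 := hasFDerivAt_apply_apply hK w v
  have h3 := h1.unique (h2.congr_of_eventuallyEq ?_)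
  · exact congrArg (fun L => L u) h3
  · filter_upwards [extChartAt_target_mem_nhds (I := 𝓘(ℝ, E)) x] with z hz
    have h4 := christoffelCoord_symm nabla htorsion (x₀ := x)
      (y := (extChartAt 𝓘(ℝ, E) x).symm z)
      (by simpa using (extChartAt 𝓘(ℝ, E) x).map_target hz) v w
    rwa [(extChartAt 𝓘(ℝ, E) x).right_inv hz] at h4

/-- The curvature in terms of the Christoffel symbols at the centre of the chart. -/
theorem curvature_eq_modelCurvature (htorsion : nabla.torsion = 0) {x : M}
    {K' : E →L[ℝ] E →L[ℝ] E →L[ℝ] E}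
    (hK : HasFDerivAt (christoffelCoord nabla x) K' (extChartAt 𝓘(ℝ, E) x x))
    (u v w : TangentSpace 𝓘(ℝ, E) x) :
    curvature nabla x u v w
      = modelCurvature (christoffelCoord nabla x (extChartAt 𝓘(ℝ, E) x x)) K' u v w := by
  have hK' := christoffelCoord_deriv_symm htorsion hK
  have hs := christoffelCoord_symm nabla htorsion (mem_chart_source E x)
  have h2 := fun u v : TangentSpace 𝓘(ℝ, E) x => nabla_nabla_of_eventuallyEq hK
    (extend_eventuallyEq_frame v) (extend_eventuallyEq_frame w) u
  unfold curvature curvatureField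
  rw [mlieBracket_extend, map_zero, sub_zero, extend_apply_self, extend_apply_self, h2, h2]
  change (_ : E) - _ = K' u v w - K' v u w + christoffelCoord nabla x _ (u : E) _ - _
  rw [hK' u v w, hK' v u w, hs v w, hs u w, hs u, hs v]
  generalize christoffelCoord nabla x (extChartAt 𝓘(ℝ, E) x x) = K
  abel

end CurvatureCoord

/-! ### The Weyl curvature in coordinates -/

section Weyl

theorem wedgeId_combination {V : Type*} [AddCommGroup V] [Module ℝ V] {s t : ℝ}
    {Q Q₁ Q₂ : V → V → ℝ} (h : ∀ a b, Q a b = s * Q₁ a b + t * Q₂ a b) (r u v w : V) :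
    r + s • wedgeId Q₁ u v w + t • wedgeId Q₂ u v w = r + wedgeId Q u v w := by
  simp only [wedgeId, h]
  module

variable {E : Type*} [NormedAddCommGroup E] [NormedSpace ℝ E]

theorem clm_add_apply {F G H : Type*} [NormedAddCommGroup F] [NormedSpace ℝ F]
    [NormedAddCommGroup G] [NormedSpace ℝ G] [NormedAddCommGroup H] [NormedSpace ℝ H]
    (L : F →L[ℝ] G →L[ℝ] H) (a b : F) (c : G) : L (a + b) c = L a c + L b c := by
  rw [map_add, add_apply]

theorem clm_smul_apply {F G H : Type*} [NormedAddCommGroup F] [NormedSpace ℝ F]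
    [NormedAddCommGroup G] [NormedSpace ℝ G] [NormedAddCommGroup H] [NormedSpace ℝ H]
    (L : F →L[ℝ] G →L[ℝ] H) (s : ℝ) (a : F) (c : G) : L (s • a) c = s • L a c := by
  rw [map_smul, smul_apply]

/-- `modelCurvature` as a trilinear map. -/
def modelCurvatureₗ (K : E →L[ℝ] E →L[ℝ] E) (K' : E →L[ℝ] E →L[ℝ] E →L[ℝ] E) :
    E →ₗ[ℝ] E →ₗ[ℝ] E →ₗ[ℝ] E :=
  LinearMap.mk₂ ℝ
    (fun u v => ((K' u v - K' v u + K u * K v - K v * K u : E →L[ℝ] E) : E →ₗ[ℝ] E))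
    (fun u₁ u₂ v => LinearMap.ext fun w => by
      change K' (u₁ + u₂) v w - K' v (u₁ + u₂) w + K (u₁ + u₂) (K v w) - K v (K (u₁ + u₂) w)
        = (K' u₁ v w - K' v u₁ w + K u₁ (K v w) - K v (K u₁ w))
          + (K' u₂ v w - K' v u₂ w + K u₂ (K v w) - K v (K u₂ w))
      rw [clm_add_apply K', clm_add_apply (K' v), clm_add_apply K, clm_add_apply K, map_add,
        add_apply]
      abel)
    (fun c u v => LinearMap.ext fun w => by
      change K' (c • u) v w - K' v (c • u) w + K (c • u) (K v w) - K v (K (c • u) w)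
        = c • (K' u v w - K' v u w + K u (K v w) - K v (K u w))
      rw [clm_smul_apply K', clm_smul_apply (K' v), clm_smul_apply K, clm_smul_apply K, map_smul,
        smul_apply]
      module)
    (fun u v₁ v₂ => LinearMap.ext fun w => by
      change K' u (v₁ + v₂) w - K' (v₁ + v₂) u w + K u (K (v₁ + v₂) w) - K (v₁ + v₂) (K u w)
        = (K' u v₁ w - K' v₁ u w + K u (K v₁ w) - K v₁ (K u w))
          + (K' u v₂ w - K' v₂ u w + K u (K v₂ w) - K v₂ (K u w))
      rw [clm_add_apply K', clm_add_apply (K' u), clm_add_apply K, clm_add_apply K, map_add,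
        add_apply]
      abel)
    (fun c u v => LinearMap.ext fun w => by
      change K' u (c • v) w - K' (c • v) u w + K u (K (c • v) w) - K (c • v) (K u w)
        = c • (K' u v w - K' v u w + K u (K v w) - K v (K u w))
      rw [clm_smul_apply K', clm_smul_apply (K' u), clm_smul_apply K, clm_smul_apply K, map_smul,
        smul_apply]
      module)

theorem modelCurvature_skew (K : E →L[ℝ] E →L[ℝ] E) (K' : E →L[ℝ] E →L[ℝ] E →L[ℝ] E)
    (u v w : E) : modelCurvature K K' u v w = -modelCurvature K K' v u w := by
  unfold modelCurvature
  abel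

theorem modelCurvature_bianchi {K : E →L[ℝ] E →L[ℝ] E} {K' : E →L[ℝ] E →L[ℝ] E →L[ℝ] E}
    (hK : ∀ u v, K u v = K v u) (hK' : ∀ u v w, K' u v w = K' u w v) (u v w : E) :
    modelCurvature K K' u v w + modelCurvature K K' v w u + modelCurvature K K' w u v = 0 := by
  unfold modelCurvature
  rw [hK v w, hK w u, hK u v, hK' u v w, hK' v w u, hK' w u v]
  abel

variable [FiniteDimensional ℝ E]
  {M : Type*} [TopologicalSpace M] [ChartedSpace E M] [IsManifold 𝓘(ℝ, E) ∞ M]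
  {nabla : Connection E M}

theorem ricci_eq_ricciForm {x : M} {R : E →ₗ[ℝ] E →ₗ[ℝ] E →ₗ[ℝ] E}
    (hR : ∀ u v w : E, curvature nabla x u v w = R u v w) (u v : E) :
    ricci nabla x u v = ricciForm R u v := by
  rw [ricciForm_apply, LinearMap.trace_eq_matrix_trace ℝ (finBasis ℝ E)]
  refine Finset.sum_congr rfl fun i _ => ?_
  rw [Matrix.diag_apply, LinearMap.toMatrix_apply, LinearMap.flip_apply, ← hR]
  rfl

theorem weyl_eq {x : M} {R : E →ₗ[ℝ] E →ₗ[ℝ] E →ₗ[ℝ] E}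
    (hR : ∀ u v w : E, curvature nabla x u v w = R u v w) (u v w : E) :
    weyl nabla x u v w = R u v w + wedgeId (fun a b => schoutenForm R a b) u v w := by
  have hr := ricci_eq_ricciForm hR
  refine (congrArg (fun r => r + (1 / ((finrank ℝ E : ℝ) - 1)) • wedgeId (ricciSymm nabla x) u v w
    + (1 / ((finrank ℝ E : ℝ) + 1)) • wedgeId (ricciSkew nabla x) u v w) (hR u v w)).trans ?_
  have h1 : ∀ a b : E, ricciSymm nabla x a b = (1 / 2) * (ricciForm R a b + ricciForm R b a) :=
    fun a b => by
      rw [← hr, ← hr]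
      unfold ricciSymm
      ring
  have h2 : ∀ a b : E, ricciSkew nabla x a b = (1 / 2) * (ricciForm R a b - ricciForm R b a) :=
    fun a b => by
      rw [← hr, ← hr]
      unfold ricciSkew
      ring
  have h3 : ∀ a b : E, schoutenForm R a b = (1 / ((finrank ℝ E : ℝ) - 1)) * ricciSymm nabla x a b
      + (1 / ((finrank ℝ E : ℝ) + 1)) * ricciSkew nabla x a b := fun a b => by
    rw [h1, h2]
    simp [schoutenForm]
    ring
  exact wedgeId_combination (V := E) h3 (R u v w) u v w

end Weyl

/-! ### The Nijenhuis tensor -/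

section Main

variable {E : Type*} [NormedAddCommGroup E] [NormedSpace ℝ E] [FiniteDimensional ℝ E]
  {M : Type*} [TopologicalSpace M] [ChartedSpace E M] [IsManifold 𝓘(ℝ, E) ∞ M]
  {nabla : Connection E M}

omit [FiniteDimensional ℝ E] in
theorem extChartAt_endModel_self (p : EndTM E M) :
    extChartAt (endModel E) p p = (extChartAt 𝓘(ℝ, E) p.1 p.1, p.2) := by
  rw [extChartAt_endModel_apply]
  exact Prod.ext rfl (ContinuousLinearMap.ext fun w => fibreCoord_self p w)

theorem twistorJ_eq_modelJ (htorsion : nabla.torsion = 0) (p : EndTM E M)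
    (ξ : TangentSpace (endModel E) p) :
    twistorJ nabla p ξ = modelJ (christoffelCoord nabla p.1) (extChartAt (endModel E) p p) ξ := by
  have h := chartDeriv_twistorJ htorsion (p₀ := p) (q := p) (mem_chart_source E p.1) ξ
  rw [chartDeriv_self, chartDeriv_self] at h
  exact h

/-- A field tangent to `J(M)` and its image under `J^∇`, in coordinates. -/
theorem eventually_chartField (htorsion : nabla.torsion = 0) {p : EndTM E M}
    {X X' : ∀ q : EndTM E M, TangentSpace (endModel E) q}
    (h : ∀ᶠ q in 𝓝[twistorSpace E M] p, X q ∈ twistorTangent q ∧ X' q = twistorJ nabla q (X q)) :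
    ∀ᶠ u in 𝓝[modelTwistor E] (extChartAt (endModel E) p p),
      chartField p X u ∈ modelTangent u ∧
        chartField p X' u = modelJ (christoffelCoord nabla p.1) u (chartField p X u) := by
  have ht : ∀ᶠ u in 𝓝[modelTwistor E] (extChartAt (endModel E) p p),
      u ∈ (extChartAt (endModel E) p).target ∧ u ∈ modelTwistor E :=
    Eventually.and (mem_nhdsWithin_of_mem_nhds (extChartAt_target_mem_nhds p)) self_mem_nhdsWithin
  have hsrc : ∀ u ∈ (extChartAt (endModel E) p).target,
      ((extChartAt (endModel E) p).symm u).1 ∈ (chartAt E p.1).source := fun u hu => by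
    have := (extChartAt (endModel E) p).map_target hu
    rwa [extChartAt_source, mem_chartAt_endTM_source] at this
  have hS : ∀ u ∈ (extChartAt (endModel E) p).target, u ∈ modelTwistor E →
      (extChartAt (endModel E) p).symm u ∈ twistorSpace E M := fun u hu hu' => by
    rw [← extChartAt_mem_modelTwistor (hsrc u hu), (extChartAt (endModel E) p).right_inv hu]
    exact hu'
  have hc : Tendsto (extChartAt (endModel E) p).symm
      (𝓝[modelTwistor E] (extChartAt (endModel E) p p)) (𝓝[twistorSpace E M] p) := by
    refine tendsto_nhdsWithin_iff.2 ⟨?_, ht.mono fun u hu => hS u hu.1 hu.2⟩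
    have := continuousAt_extChartAt_symm (I := endModel E) p
    rw [ContinuousAt, extChartAt_to_inv] at this
    exact this.mono_left nhdsWithin_le_nhds
  filter_upwards [hc.eventually h, ht] with u hu hu'
  have h1 := chartDeriv_mem_modelTangent htorsion (hsrc u hu'.1) (hS u hu'.1 hu'.2)
    (X ((extChartAt (endModel E) p).symm u))
  have h2 := chartDeriv_twistorJ htorsion (hsrc u hu'.1) (X ((extChartAt (endModel E) p).symm u))
  rw [(extChartAt (endModel E) p).right_inv hu'.1] at h1 h2
  exact ⟨h1.2 hu.1, (congrArg _ hu.2).trans h2⟩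

omit [FiniteDimensional ℝ E] in
theorem chartField_self (p : EndTM E M) (X : ∀ q : EndTM E M, TangentSpace (endModel E) q) :
    chartField p X (extChartAt (endModel E) p p) = (horizontalPart (X p), fibrePart (X p)) := by
  unfold chartField
  rw [extChartAt_to_inv, chartDeriv_self]

/-- Smoothness of a vector field of `End(TM)` at a point. -/
abbrev SmoothFieldAt (X : ∀ q : EndTM E M, TangentSpace (endModel E) q) (p : EndTM E M) : Prop :=
  ContMDiffAt (endModel E) (endModel E).tangent ∞
    (fun q => (⟨q, X q⟩ : TangentBundle (endModel E) (EndTM E M))) p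

variable [T2Space M]

/-- The Nijenhuis tensor of `J^∇` is vertical and given by the type obstruction of the curvature. -/
theorem nijenhuis_twistorJ (hsmooth : CovariantDerivative.ContMDiffCovariantDerivative nabla ∞)
    (htorsion : nabla.torsion = 0) {p : EndTM E M} (hp : p ∈ twistorSpace E M)
    {X Y X' Y' : ∀ q : EndTM E M, TangentSpace (endModel E) q}
    (hX : SmoothFieldAt X p) (hY : SmoothFieldAt Y p)
    (hX' : SmoothFieldAt X' p) (hY' : SmoothFieldAt Y' p)
    (hXX' : ∀ᶠ q in 𝓝[twistorSpace E M] p,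
      X q ∈ twistorTangent q ∧ X' q = twistorJ nabla q (X q))
    (hYY' : ∀ᶠ q in 𝓝[twistorSpace E M] p,
      Y q ∈ twistorTangent q ∧ Y' q = twistorJ nabla q (Y q)) :
    horizontalPart (mlieBracket (endModel E) X' Y' p
      - twistorJ nabla p (mlieBracket (endModel E) X' Y p)
      - twistorJ nabla p (mlieBracket (endModel E) X Y' p) - mlieBracket (endModel E) X Y p) = 0 ∧
    ∀ z : TangentSpace 𝓘(ℝ, E) p.1, fibrePart (mlieBracket (endModel E) X' Y' p
      - twistorJ nabla p (mlieBracket (endModel E) X' Y p)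
      - twistorJ nabla p (mlieBracket (endModel E) X Y' p) - mlieBracket (endModel E) X Y p) z
      = -typeObstruction (curvature nabla p.1) p.2 (horizontalPart (X p)) (horizontalPart (Y p)) z
    := by
  have : CompleteSpace E := FiniteDimensional.complete ℝ E
  have hself := extChartAt_endModel_self p
  obtain ⟨K', hK'⟩ : ∃ K', HasFDerivAt (christoffelCoord nabla p.1) K'
      (extChartAt 𝓘(ℝ, E) p.1 p.1) :=
    ⟨_, ((contDiffAt_christoffelCoord nabla hsmooth p.1).differentiableAt (by simp)).hasFDerivAt⟩
  have hK : HasFDerivAt (christoffelCoord nabla p.1) K' (extChartAt (endModel E) p p).1 := by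
    rwa [hself]
  have hsymm : ∀ u v, christoffelCoord nabla p.1 (extChartAt (endModel E) p p).1 u v
      = christoffelCoord nabla p.1 (extChartAt (endModel E) p p).1 v u := by
    rw [hself]
    exact christoffelCoord_symm nabla htorsion (mem_chart_source E p.1)
  have hd : ∀ {Z : ∀ q : EndTM E M, TangentSpace (endModel E) q}, SmoothFieldAt Z p →
      DifferentiableAt ℝ (chartField p Z) (extChartAt (endModel E) p p) := fun h =>
    (contDiffAt_chartField h).differentiableAt (by simp)
  have h := nijenhuis_modelJ hK hsymm
    ((extChartAt_mem_modelTwistor (mem_chart_source E p.1)).2 hp)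
    (hd hX) (hd hX') (hd hY) (hd hY') (eventually_chartField htorsion hXX')
    (eventually_chartField htorsion hYY')
  rw [twistorJ_eq_modelJ htorsion, twistorJ_eq_modelJ htorsion,
    mlieBracket_eq_lieBracket_chartField, mlieBracket_eq_lieBracket_chartField,
    mlieBracket_eq_lieBracket_chartField, mlieBracket_eq_lieBracket_chartField]
  refine ⟨h.1, fun z => (h.2 z).trans ?_⟩
  have hc : curvature nabla p.1 = fun u v w =>
      modelCurvature (christoffelCoord nabla p.1 (extChartAt 𝓘(ℝ, E) p.1 p.1)) K' u v w := by
    funext u v w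
    exact curvature_eq_modelCurvature htorsion hK' u v w
  rw [chartField_self, chartField_self, hself, hc]
  rfl

end Main

/-! ### Integrability -/

section Main

variable {E : Type*} [NormedAddCommGroup E] [NormedSpace ℝ E] [FiniteDimensional ℝ E]
  {M : Type*} [TopologicalSpace M] [ChartedSpace E M] [IsManifold 𝓘(ℝ, E) ∞ M]
  {nabla : Connection E M}

omit [FiniteDimensional ℝ E] in
theorem contDiffAt_modelJ {K : E → E →L[ℝ] E →L[ℝ] E} {p : E × (E →L[ℝ] E)}
    (hK : ContDiffAt ℝ ∞ K p.1) (v : E) :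
    ContDiffAt ℝ ∞ (fun q => modelJ K q (v, 0)) p := by
  have hfst : ContDiffAt ℝ ∞ (fun q : E × (E →L[ℝ] E) => q.1) p := contDiffAt_fst
  have hsnd : ContDiffAt ℝ ∞ (fun q : E × (E →L[ℝ] E) => q.2) p := contDiffAt_snd
  have hK1 : ContDiffAt ℝ ∞ (fun q : E × (E →L[ℝ] E) => K q.1) p := ContDiffAt.comp p hK hfst
  have hv : ContDiffAt ℝ ∞ (fun q : E × (E →L[ℝ] E) => q.2 v) p := hsnd.clm_apply contDiffAt_const
  have hKv : ContDiffAt ℝ ∞ (fun q : E × (E →L[ℝ] E) => K q.1 v) p :=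
    ContDiffAt.clm_apply (F := E) (G := E →L[ℝ] E) hK1 contDiffAt_const
  have hKw : ContDiffAt ℝ ∞ (fun q : E × (E →L[ℝ] E) => K q.1 (q.2 v)) p :=
    ContDiffAt.clm_apply (F := E) (G := E →L[ℝ] E) hK1 hv
  exact hv.prodMk ((hsnd.mul (contDiffAt_const.add ((hKv.mul hsnd).sub (hsnd.mul hKv)))).sub
    ((hKw.mul hsnd).sub (hsnd.mul hKw)))

variable [T2Space M]

/-- Every tangent vector of `M` is the horizontal part of a smooth local vector field of `J(M)`. -/
theorem exists_twistor_field (hsmooth : CovariantDerivative.ContMDiffCovariantDerivative nabla ∞)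
    (htorsion : nabla.torsion = 0) (p : EndTM E M) (v : TangentSpace 𝓘(ℝ, E) p.1) :
    ∃ X X' : ∀ q : EndTM E M, TangentSpace (endModel E) q,
      SmoothFieldAt X p ∧ SmoothFieldAt X' p ∧
      (∀ᶠ q in 𝓝[twistorSpace E M] p, X q ∈ twistorTangent q ∧ X' q = twistorJ nabla q (X q)) ∧
      horizontalPart (X p) = v := by
  have : CompleteSpace E := FiniteDimensional.complete ℝ E
  -- In the chart around `p` the field `X` has the constant coordinates `(v, 0)`.
  obtain ⟨X, hX, hXv⟩ := exists_chartField_eq p (V := fun _ => (show E from v, 0))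
    contDiffAt_const
  obtain ⟨X', hX', hXv'⟩ := exists_chartField_eq p
    (V := fun q => modelJ (christoffelCoord nabla p.1) q (show E from v, 0))
    (contDiffAt_modelJ (E := E) (by
      rw [extChartAt_endModel_self]
      exact contDiffAt_christoffelCoord nabla hsmooth p.1) v)
  refine ⟨X, X', hX, hX', ?_, ?_⟩
  · filter_upwards [mem_nhdsWithin_of_mem_nhds hXv, mem_nhdsWithin_of_mem_nhds hXv',
      mem_nhdsWithin_of_mem_nhds (extChartAt_source_mem_nhds (I := endModel E) p),
      self_mem_nhdsWithin] with q h h' hq hqS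
    have hq' : q.1 ∈ (chartAt E p.1).source := by
      rwa [extChartAt_source, mem_chartAt_endTM_source] at hq
    have hinj : Function.Injective (chartDeriv p q) := by
      obtain ⟨e, he⟩ := isInvertible_mfderiv_extChartAt hq
      intro a b hab
      unfold chartDeriv at hab
      rw [← he] at hab
      exact e.injective hab
    refine ⟨(chartDeriv_mem_modelTangent htorsion hq' hqS _).1 ?_, hinj ?_⟩
    · rw [h]
      change _ * (0 : E →L[ℝ] E) + 0 * _ = 0
      rw [mul_zero, zero_mul, add_zero]
    · rw [h', chartDeriv_twistorJ htorsion hq', h]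
  · have h := hXv.self_of_nhds
    rw [chartDeriv_self] at h
    exact congrArg Prod.fst h

theorem twistorIntegrable_iff_typeObstruction
    (hsmooth : CovariantDerivative.ContMDiffCovariantDerivative nabla ∞)
    (htorsion : nabla.torsion = 0) :
    TwistorIntegrable nabla ↔ ∀ p ∈ twistorSpace E M, ∀ u v z : TangentSpace 𝓘(ℝ, E) p.1,
      typeObstruction (curvature nabla p.1) p.2 u v z = 0 := by
  constructor
  · intro h p hp u v z
    obtain ⟨X, X', hX, hX', hXX', rfl⟩ := exists_twistor_field hsmooth htorsion p u
    obtain ⟨Y, Y', hY, hY', hYY', rfl⟩ := exists_twistor_field hsmooth htorsion p v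
    have h1 := (nijenhuis_twistorJ hsmooth htorsion hp hX hY hX' hY' hXX' hYY').2 z
    rw [h p hp X Y X' Y' hX hY hX' hY' hXX' hYY'] at h1
    exact neg_eq_zero.1 h1.symm
  · intro h p hp X Y X' Y' hX hY hX' hY' hXX' hYY'
    have h1 := nijenhuis_twistorJ hsmooth htorsion hp hX hY hX' hY' hXX' hYY'
    refine Prod.ext h1.1 (ContinuousLinearMap.ext fun z => (h1.2 z).trans ?_)
    exact neg_eq_zero.2 (h p hp _ _ _)

theorem twistorIntegrable_iff_weyl_eq_zero (hn : Even (finrank ℝ E))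
    (hsmooth : CovariantDerivative.ContMDiffCovariantDerivative nabla ∞)
    (htorsion : nabla.torsion = 0) :
    TwistorIntegrable nabla ↔
      ∀ (x : M) (u v w : TangentSpace 𝓘(ℝ, E) x), weyl nabla x u v w = 0 := by
  rw [twistorIntegrable_iff_typeObstruction hsmooth htorsion]
  have key : ∀ x : M, (∀ j : E →ₗ[ℝ] E, (∀ w, j (j w) = -w) → ∀ u v z : E,
      typeObstruction (V := E) (curvature nabla x) j u v z = 0) ↔
        ∀ u v w : E, weyl nabla x u v w = 0 := fun x => by
    have hK := ((contDiffAt_christoffelCoord nabla hsmooth x).differentiableAt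
      (by simp)).hasFDerivAt
    set K := christoffelCoord nabla x (extChartAt 𝓘(ℝ, E) x x)
    generalize fderiv ℝ (christoffelCoord nabla x) (extChartAt 𝓘(ℝ, E) x x) = K' at hK
    have hR : ∀ u v w : E, curvature nabla x u v w = modelCurvatureₗ K K' u v w := fun u v w =>
      curvature_eq_modelCurvature htorsion hK u v w
    have h := forall_typeObstruction_eq_zero_iff hn (R := modelCurvatureₗ K K')
      (fun u v w => modelCurvature_skew K K' u v w)
      (fun u v w => modelCurvature_bianchi
        (christoffelCoord_symm nabla htorsion (mem_chart_source E x))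
        (christoffelCoord_deriv_symm htorsion hK) u v w)
    have hc : curvature nabla x = fun u v w => modelCurvatureₗ K K' u v w := by
      funext u v w
      exact hR u v w
    rw [hc]
    refine h.trans (forall₃_congr fun u v w => ?_)
    rw [weyl_eq hR]
    rfl
  constructor
  · intro h x
    refine (key x).1 fun j hj => ?_
    exact h (TotalSpace.mk' _ x (show E →L[ℝ] E from LinearMap.toContinuousLinearMap j)) hj
  · intro h p hp
    exact (key p.1).2 (h p.1) (show E →L[ℝ] E from p.2).toLinearMap hp

end Main

end TwistorWeyl

end


theorem mainTheorem2 {n : ℕ} (hn : Even n)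
    {M : Type*} [TopologicalSpace M] [T2Space M]
    [ChartedSpace (EuclideanSpace ℝ (Fin n)) M]
    [IsManifold 𝓘(ℝ, EuclideanSpace ℝ (Fin n)) ∞ M]
    (nabla : TwistorWeyl.Connection (EuclideanSpace ℝ (Fin n)) M)
    (hsmooth : CovariantDerivative.ContMDiffCovariantDerivative nabla ∞)
    (htorsion : nabla.torsion = 0) :
    TwistorWeyl.TwistorIntegrable nabla ↔
      ∀ (x : M) (u v w : TangentSpace 𝓘(ℝ, EuclideanSpace ℝ (Fin n)) x),
        TwistorWeyl.weyl nabla x u v w = 0 :=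
  TwistorWeyl.twistorIntegrable_iff_weyl_eq_zero (by rwa [finrank_euclideanSpace_fin]) hsmooth
    htorsion
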